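/- **Diagrams.** A diagram is a finite connected multigraph (loops and multiple edges allowed) with at least one trivalent vertex, in which every vertex is trivalent, with a cyclic ordering of its three incoming half-edges, or univalent, with a colour. For a partition $u=(u_1,\dots,u_k)$ a diagram is $u$-coloured if its univalent vertices have colours in $\{1,\dots,k\}$ and exactly $u_i$ of them have colour $i$ for each $i$. In pictures the cyclic orderings are counter-clockwise. Let $\hat B(u)$ be the $\mathbb{Q}$-vector space spanned by the isomorphism classes of $u$-coloured diagrams, modulo the following local relations. * (AS): reversing the cyclic ordering at one trivalent vertex multiplies the diagram by $-1$. * (IHX): $I = H - X$, where $H$ is a letter H (two vertical strands joined by a horizontal edge), $I$ is $H$ rotated by a right angle with the four ends in the same places, and $X$ is $H$ with its two lower ends crossed. * (x): for every $n\ge 1$, a diagram vanishes if it contains the following piece: $n$ edges ("rungs") join a strand to a loop, meeting both in the same order, and the loop has one further trivalent vertex, by which it is attached to the rest of the diagram. **Ladders.** For $n\ge 2$, the $n$-ladder is the planar piece formed by two vertical strands joined by $n$ horizontal rungs. Its four ends are the two upper and the two lower ends of the strands. The two upper ends are neighbouring, and so are the two lower ends. **Theorem.** Let $u$ be any partition.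 The following local relations hold in $\hat B(u)$. In each of them the diagrams agree outside the piece shown, and the four free ends of the piece are attached to four given places $1,2,3,4$ of the rest of the diagram. (The rest may be disconnected, may join some of these places directly to each other, and completes the pieces to $u$-coloured diagrams.) * (LS) For $m\ge1$, the element represented by a diagram that contains a $2m$-ladder does not depend on which of the ladder's four ends is attached to which of the four places. * (LIHX) For $m\ge1$, let $D_1$, $D_2$, $D_3$ be three diagrams in which the four ends of a $(2m+1)$-ladder are attached to the four places such that the pairs of places receiving neighbouring ends are $\{1,2\},\{3,4\}$ in $D_1$, $\{1,3\},\{2,4\}$ in $D_2$, and $\{1,4\},\{2,3\}$ in $D_3$. Then $D_1+D_2+D_3=0$. * (LI) For $m\ge1$, glue an additional edge to two non-neighbouring ends $e,f$ of a $(2m+1)$-ladder: draw $e$ and $f$ as parallel strands leaving the ladder, and join them by a rung drawn between them. The resulting element equals $-\tfrac12$ times the element in which this whole piece is replaced by a $(2m+2)$-ladder attached to the same four places. * (LL) For $n,m\ge1$, place a $(2n+1)$-ladder and a $(2m+1)$-ladder in parallel: join two non-neighbouring ends of the first ladder to two non-neighbouring ends of the second (in the standard planar picture, the right strand of the first ladder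 and the left strand of the second are closed up to a common loop), and attach the remaining four ends to the four places. The resulting element equals $\tfrac14$ times the element in which this whole piece is replaced by a $(2n+2m+2)$-ladder attached to the same four places. -/

import Mathlib

/-!  Every graph is described by its half-edges.  `edge` is the involution that exchanges the two
halves of an edge, `vertex` sends a half-edge at a trivalent vertex to its counter-clockwise
successor at that vertex.  A univalent vertex is identified with its only half-edge. -/

/-- `x` and `y` are joined by a chain of steps, each of them an application of `f` or of `g`. -/
def Linked {α : Type} (f g : α → α) : α → α → Prop :=
  Relation.EqvGen fun x y => y = f x ∨ y = g x

/-- A `u`-coloured diagram: a finite connected multigraph with at least one trivalent vertex, all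
of whose vertices are trivalent with a cyclic ordering of the incoming half-edges, or univalent
with a colour, such that exactly `u i` univalent vertices have the colour `i`.
Loops and multiple edges are allowed. -/
structure Diagram {k : ℕ} (u : Fin k → ℕ) : Type 1 where
  /-- the half-edges at trivalent vertices -/
  H : Type
  /-- the univalent vertices -/
  U : Type
  finite_H : Finite H
  finite_U : Finite U
  nonempty_H : Nonempty H
  vertex : Equiv.Perm H
  vertex_cube : ∀ h, vertex (vertex (vertex h)) = h
  vertex_ne : ∀ h, vertex h ≠ h
  edge : Equiv.Perm (H ⊕ U)
  edge_edge : ∀ x, edge (edge x) = x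
  edge_ne : ∀ x, edge x ≠ x
  color : U → Fin k
  card_color : ∀ i, Nat.card {v : U // color v = i} = u i
  connected : ∀ x y, Linked edge (Sum.map vertex id) x y

/-- An isomorphism of diagrams, respecting the cyclic orderings and the colours. -/
structure Diagram.Iso {k : ℕ} {u : Fin k → ℕ} (D D' : Diagram u) where
  onH : D.H ≃ D'.H
  onU : D.U ≃ D'.U
  map_vertex : ∀ h, onH (D.vertex h) = D'.vertex (onH h)
  map_edge : ∀ x, Sum.map onH onU (D.edge x) = D'.edge (Sum.map onH onU x)
  map_color : ∀ v, D'.color (onU v) = D.color v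

/-- A connected piece of a diagram, without univalent vertices, with cut edges: its half-edges are
the elements of `I` (whose edge lies inside the piece) and those of `B` (which belong to the cut
edges, the *ends* of the piece). -/
structure Piece (B : Type) : Type 1 where
  I : Type
  finite_I : Finite I
  nonempty : Nonempty (I ⊕ B)
  vertex : Equiv.Perm (I ⊕ B)
  vertex_cube : ∀ h, vertex (vertex (vertex h)) = h
  vertex_ne : ∀ h, vertex h ≠ h
  edge : Equiv.Perm I
  edge_edge : ∀ x, edge (edge x) = x
  edge_ne : ∀ x, edge x ≠ x
  connected : ∀ x y, Linked vertex (Sum.map edge id) x y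

/-- What remains of a `u`-coloured diagram outside of a connected piece with ends `B`. Every end
is continued by `edge`, to a half-edge at a trivalent vertex, to a univalent vertex or to
another end. The rest may be disconnected, but each of its components has to reach an end. -/
structure Rest (B : Type) {k : ℕ} (u : Fin k → ℕ) : Type 1 where
  /-- the half-edges at trivalent vertices -/
  K : Type
  /-- the univalent vertices -/
  U : Type
  finite_K : Finite K
  finite_U : Finite U
  vertex : Equiv.Perm K
  vertex_cube : ∀ h, vertex (vertex (vertex h)) = h
  vertex_ne : ∀ h, vertex h ≠ h
  edge : Equiv.Perm (B ⊕ (K ⊕ U))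
  edge_edge : ∀ x, edge (edge x) = x
  edge_ne : ∀ x, edge x ≠ x
  color : U → Fin k
  card_color : ∀ i, Nat.card {v : U // color v = i} = u i
  reach : ∀ x, ∃ b, Linked edge (Sum.map id (Sum.map vertex id)) (Sum.inl b) x

theorem Linked.map {α β : Type} {f g : α → α} {f' g' : β → β} (φ : α → β)
    (hf : ∀ x, Linked f' g' (φ x) (φ (f x))) (hg : ∀ x, Linked f' g' (φ x) (φ (g x)))
    {x y : α} (h : Linked f g x y) : Linked f' g' (φ x) (φ y) := by
  induction h with
  | rel a b hab =>
    rcases hab with rfl | rfl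
    · exact hf a
    · exact hg a
  | refl a => exact Relation.EqvGen.refl _
  | symm a b _ ih => exact Relation.EqvGen.symm _ _ ih
  | trans a b c _ _ ih₁ ih₂ => exact Relation.EqvGen.trans _ _ _ ih₁ ih₂

theorem Linked.left {α : Type} {f g : α → α} (x : α) {y : α} (h : y = f x) : Linked f g x y :=
  Relation.EqvGen.rel _ _ (Or.inl h)

theorem Linked.right {α : Type} {f g : α → α} (x : α) {y : α} (h : y = g x) : Linked f g x y :=
  Relation.EqvGen.rel _ _ (Or.inr h)

/-- The bijection that lists the half-edges of a piece and of the rest in two ways. -/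
def regroup (I B K U : Type) : ((I ⊕ B) ⊕ K) ⊕ U ≃ I ⊕ (B ⊕ (K ⊕ U)) :=
  (Equiv.sumAssoc (I ⊕ B) K U).trans (Equiv.sumAssoc I B (K ⊕ U))

/-- The diagram that consists of the piece `P` and the rest `C`, glued along the ends. -/
def Rest.fill {B : Type} [Finite B] {k : ℕ} {u : Fin k → ℕ} (C : Rest B u) (P : Piece B) :
    Diagram u where
  H := (P.I ⊕ B) ⊕ C.K
  U := C.U
  finite_H := by
    have := P.finite_I
    have := C.finite_K
    infer_instance
  finite_U := C.finite_U
  nonempty_H := P.nonempty.map Sum.inl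
  vertex := Equiv.sumCongr P.vertex C.vertex
  vertex_cube := by
    rintro (h | h)
    · simp [P.vertex_cube]
    · simp [C.vertex_cube]
  vertex_ne := by
    rintro (h | h)
    · simpa using P.vertex_ne h
    · simpa using C.vertex_ne h
  edge := (regroup P.I B C.K C.U).trans
    ((Equiv.sumCongr P.edge C.edge).trans (regroup P.I B C.K C.U).symm)
  edge_edge := by
    intro x
    obtain ⟨y, rfl⟩ := (regroup P.I B C.K C.U).symm.surjective x
    rcases y with y | y
    · simp [P.edge_edge]
    · simp [C.edge_edge]
  edge_ne := by
    intro x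
    obtain ⟨y, rfl⟩ := (regroup P.I B C.K C.U).symm.surjective x
    rcases y with y | y
    · simpa using P.edge_ne y
    · simpa using C.edge_ne y
  color := C.color
  card_color := C.card_color
  connected := by
    set e := regroup P.I B C.K C.U with he
    have h1 : ∀ a b : P.I ⊕ B, Linked (e.trans ((Equiv.sumCongr P.edge C.edge).trans e.symm))
        (Sum.map (Equiv.sumCongr P.vertex C.vertex) id)
        (Sum.inl (Sum.inl a)) (Sum.inl (Sum.inl b)) := by
      intro a b
      refine Linked.map (fun x => Sum.inl (Sum.inl x)) (fun x => ?_) (fun x => ?_)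
        (P.connected a b)
      · exact Linked.right _ (by simp)
      · rcases x with x | x
        · exact Linked.left _ (by simp [he, regroup])
        · exact Relation.EqvGen.refl _
    have h2 : ∀ x y : B ⊕ (C.K ⊕ C.U),
        Linked C.edge (Sum.map id (Sum.map C.vertex id)) x y →
        Linked (e.trans ((Equiv.sumCongr P.edge C.edge).trans e.symm))
        (Sum.map (Equiv.sumCongr P.vertex C.vertex) id)
        (e.symm (Sum.inr x)) (e.symm (Sum.inr y)) := by
      intro x y h
      refine Linked.map (fun x => e.symm (Sum.inr x)) (fun x => ?_) (fun x => ?_) h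
      · exact Linked.left _ (by simp)
      · rcases x with x | x | x
        · exact Relation.EqvGen.refl _
        · exact Linked.right _ (by simp [he, regroup])
        · exact Relation.EqvGen.refl _
    have h3 : ∀ x, ∃ a, Linked (e.trans ((Equiv.sumCongr P.edge C.edge).trans e.symm))
        (Sum.map (Equiv.sumCongr P.vertex C.vertex) id) (Sum.inl (Sum.inl a)) x := by
      intro x
      obtain ⟨y, rfl⟩ := e.symm.surjective x
      rcases y with y | y
      · exact ⟨Sum.inl y, Relation.EqvGen.refl _⟩
      · obtain ⟨b, hb⟩ := C.reach y
        exact ⟨Sum.inr b, h2 _ _ hb⟩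
    intro x y
    obtain ⟨a, ha⟩ := h3 x
    obtain ⟨b, hb⟩ := h3 y
    exact Relation.EqvGen.trans _ _ _ (Relation.EqvGen.symm _ _ ha) (Relation.EqvGen.trans _ _ _ (h1 a b) hb)

/-- The same piece with renamed ends: the end `b` gets the name `s b`. -/
def Piece.rename {B B' : Type} (P : Piece B) (s : B ≃ B') : Piece B' where
  I := P.I
  finite_I := P.finite_I
  nonempty := P.nonempty.map (Sum.map id s)
  vertex := ((Equiv.sumCongr (Equiv.refl P.I) s).symm.trans P.vertex).trans
    (Equiv.sumCongr (Equiv.refl P.I) s)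
  vertex_cube := by
    intro h
    obtain ⟨h, rfl⟩ := (Equiv.sumCongr (Equiv.refl P.I) s).surjective h
    simp only [Equiv.trans_apply, Equiv.symm_apply_apply, P.vertex_cube]
  vertex_ne := by
    intro h
    obtain ⟨h, rfl⟩ := (Equiv.sumCongr (Equiv.refl P.I) s).surjective h
    simp only [Equiv.trans_apply, Equiv.symm_apply_apply, ne_eq, EmbeddingLike.apply_eq_iff_eq]
    exact P.vertex_ne h
  edge := P.edge
  edge_edge := P.edge_edge
  edge_ne := P.edge_ne
  connected := by
    intro x y
    obtain ⟨x, rfl⟩ := (Equiv.sumCongr (Equiv.refl P.I) s).surjective x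
    obtain ⟨y, rfl⟩ := (Equiv.sumCongr (Equiv.refl P.I) s).surjective y
    refine Linked.map _ (fun z => ?_) (fun z => ?_) (P.connected x y)
    · exact Linked.left _ (by simp only [Equiv.trans_apply, Equiv.symm_apply_apply])
    · refine Linked.right _ ?_
      rcases z with z | z <;> simp

/-- The bijection that lists the half-edges of two glued pieces in two ways. -/
def regroupGlue (I J A M E : Type) :
    ((I ⊕ J) ⊕ (M ⊕ M)) ⊕ (A ⊕ E) ≃ (I ⊕ (A ⊕ M)) ⊕ (J ⊕ (M ⊕ E)) where
  toFun
    | Sum.inl (Sum.inl (Sum.inl i)) => Sum.inl (Sum.inl i)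
    | Sum.inl (Sum.inl (Sum.inr j)) => Sum.inr (Sum.inl j)
    | Sum.inl (Sum.inr (Sum.inl m)) => Sum.inl (Sum.inr (Sum.inr m))
    | Sum.inl (Sum.inr (Sum.inr m)) => Sum.inr (Sum.inr (Sum.inl m))
    | Sum.inr (Sum.inl a) => Sum.inl (Sum.inr (Sum.inl a))
    | Sum.inr (Sum.inr c) => Sum.inr (Sum.inr (Sum.inr c))
  invFun
    | Sum.inl (Sum.inl i) => Sum.inl (Sum.inl (Sum.inl i))
    | Sum.inr (Sum.inl j) => Sum.inl (Sum.inl (Sum.inr j))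
    | Sum.inl (Sum.inr (Sum.inr m)) => Sum.inl (Sum.inr (Sum.inl m))
    | Sum.inr (Sum.inr (Sum.inl m)) => Sum.inl (Sum.inr (Sum.inr m))
    | Sum.inl (Sum.inr (Sum.inl a)) => Sum.inr (Sum.inl a)
    | Sum.inr (Sum.inr (Sum.inr c)) => Sum.inr (Sum.inr c)
  left_inv := by rintro (((_ | _) | (_ | _)) | (_ | _)) <;> rfl
  right_inv := by rintro ((_ | (_ | _)) | (_ | (_ | _))) <;> rfl

/-- The piece obtained from `P` and `Q` by gluing, for every `m : M`, the end `Sum.inr m` of `P`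
to the end `Sum.inl m` of `Q`. -/
def Piece.glue {A M E : Type} [Finite M] [Nonempty M] (P : Piece (A ⊕ M)) (Q : Piece (M ⊕ E)) :
    Piece (A ⊕ E) where
  I := (P.I ⊕ Q.I) ⊕ (M ⊕ M)
  finite_I := by
    have := P.finite_I
    have := Q.finite_I
    infer_instance
  nonempty := ⟨Sum.inl (Sum.inr (Sum.inl (Classical.arbitrary M)))⟩
  vertex := (regroupGlue P.I Q.I A M E).trans
    ((Equiv.sumCongr P.vertex Q.vertex).trans (regroupGlue P.I Q.I A M E).symm)
  vertex_cube := by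
    intro x
    obtain ⟨y, rfl⟩ := (regroupGlue P.I Q.I A M E).symm.surjective x
    rcases y with y | y
    · simp [P.vertex_cube]
    · simp [Q.vertex_cube]
  vertex_ne := by
    intro x
    obtain ⟨y, rfl⟩ := (regroupGlue P.I Q.I A M E).symm.surjective x
    rcases y with y | y
    · simpa using P.vertex_ne y
    · simpa using Q.vertex_ne y
  edge := Equiv.sumCongr (Equiv.sumCongr P.edge Q.edge) (Equiv.sumComm M M)
  edge_edge := by
    rintro ((x | x) | (x | x)) <;> simp [P.edge_edge, Q.edge_edge]
  edge_ne := by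
    rintro ((x | x) | (x | x)) <;> simp [P.edge_ne, Q.edge_ne]
  connected := by
    set e := regroupGlue P.I Q.I A M E with he
    set R := Linked (e.trans ((Equiv.sumCongr P.vertex Q.vertex).trans e.symm))
      (Sum.map (Equiv.sumCongr (Equiv.sumCongr P.edge Q.edge) (Equiv.sumComm M M)) id) with hR
    have hP : ∀ a b, R (e.symm (Sum.inl a)) (e.symm (Sum.inl b)) := by
      intro a b
      refine Linked.map (fun x => e.symm (Sum.inl x)) (fun x => ?_) (fun x => ?_)
        (P.connected a b)
      · exact Linked.left _ (by simp)
      · rcases x with x | x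
        · exact Linked.right _ rfl
        · exact Relation.EqvGen.refl _
    have hQ : ∀ a b, R (e.symm (Sum.inr a)) (e.symm (Sum.inr b)) := by
      intro a b
      refine Linked.map (fun x => e.symm (Sum.inr x)) (fun x => ?_) (fun x => ?_)
        (Q.connected a b)
      · exact Linked.left _ (by simp)
      · rcases x with x | x
        · exact Linked.right _ rfl
        · exact Relation.EqvGen.refl _
    obtain ⟨m⟩ := ‹Nonempty M›
    have hPQ : R (e.symm (Sum.inl (Sum.inr (Sum.inr m)))) (e.symm (Sum.inr (Sum.inr (Sum.inl m)))) :=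
      Linked.right _ rfl
    have h0 : ∀ x, R (e.symm (Sum.inl (Sum.inr (Sum.inr m)))) x := by
      intro x
      obtain ⟨y, rfl⟩ := e.symm.surjective x
      rcases y with y | y
      · exact hP _ _
      · exact Relation.EqvGen.trans _ _ _ hPQ (hQ _ _)
    intro x y
    exact Relation.EqvGen.trans _ _ _ (Relation.EqvGen.symm _ _ (h0 x)) (h0 y)

/-- A single trivalent vertex; its ends are in the counter-clockwise order `0, 1, 2`. -/
def tripod : Piece (Fin 3) where
  I := Empty
  finite_I := inferInstance
  nonempty := ⟨Sum.inr 0⟩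
  vertex := Equiv.sumCongr (Equiv.refl Empty) (finRotate 3)
  vertex_cube := by decide
  vertex_ne := by decide
  edge := Equiv.refl Empty
  edge_edge := by decide
  edge_ne := by decide
  connected := by
    have h : ∀ i : Fin 3, Linked (Equiv.sumCongr (Equiv.refl Empty) (finRotate 3))
        (Sum.map (Equiv.refl Empty) id) (Sum.inr 0) (Sum.inr i) := by
      have h01 : Linked (Equiv.sumCongr (Equiv.refl Empty) (finRotate 3))
        (Sum.map (Equiv.refl Empty) id) (Sum.inr 0) (Sum.inr 1) := Linked.left _ (by decide)
      have h12 : Linked (Equiv.sumCongr (Equiv.refl Empty) (finRotate 3))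
        (Sum.map (Equiv.refl Empty) id) (Sum.inr 1) (Sum.inr 2) := Linked.left _ (by decide)
      intro i
      fin_cases i
      · exact Relation.EqvGen.refl _
      · exact h01
      · exact Relation.EqvGen.trans _ _ _ h01 h12
    rintro (x | x) (y | y)
    · exact x.elim
    · exact x.elim
    · exact y.elim
    · exact Relation.EqvGen.trans _ _ _ (Relation.EqvGen.symm _ _ (h x)) (h y)

/-- The names of the four ends of a ladder drawn upright, with vertical strands and horizontal
rungs. -/
abbrev Ends : Type := Fin 2 ⊕ Fin 2

/-- top left -/
abbrev tl : Ends := Sum.inl 0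
/-- top right -/
abbrev tr : Ends := Sum.inl 1
/-- bottom left -/
abbrev bl : Ends := Sum.inr 0
/-- bottom right -/
abbrev br : Ends := Sum.inr 1

/-- The permutation of the half-edges of a letter H with the counter-clockwise cycles
(rung, top, bottom) at the left vertex and (rung, bottom, top) at the right vertex. -/
def rungVertex : Equiv.Perm (Fin 2 ⊕ Ends) where
  toFun
    | Sum.inl 0 => Sum.inr tl
    | Sum.inr (Sum.inl 0) => Sum.inr bl
    | Sum.inr (Sum.inr 0) => Sum.inl 0
    | Sum.inl 1 => Sum.inr br
    | Sum.inr (Sum.inr 1) => Sum.inr tr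
    | Sum.inr (Sum.inl 1) => Sum.inl 1
  invFun
    | Sum.inl 0 => Sum.inr bl
    | Sum.inr (Sum.inl 0) => Sum.inl 0
    | Sum.inr (Sum.inr 0) => Sum.inr tl
    | Sum.inl 1 => Sum.inr tr
    | Sum.inr (Sum.inr 1) => Sum.inl 1
    | Sum.inr (Sum.inl 1) => Sum.inr br
  left_inv := by decide
  right_inv := by decide

/-- A letter H: two vertical strands, joined by one horizontal rung. -/
def rung : Piece Ends where
  I := Fin 2
  finite_I := inferInstance
  nonempty := ⟨Sum.inl 0⟩
  vertex := rungVertex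
  vertex_cube := by decide
  vertex_ne := by decide
  edge := Equiv.swap 0 1
  edge_edge := by decide
  edge_ne := by decide
  connected := by
    have v : ∀ x y, y = rungVertex x →
        Linked rungVertex (Sum.map (Equiv.swap (0 : Fin 2) 1) id) x y :=
      fun x y h => Linked.left x h
    have h01 : Linked rungVertex (Sum.map (Equiv.swap (0 : Fin 2) 1) id)
        (Sum.inl 0) (Sum.inl 1) := Linked.right _ (by decide)
    have h : ∀ x, Linked rungVertex (Sum.map (Equiv.swap (0 : Fin 2) 1) id) (Sum.inl 0) x := by
      have a := v (Sum.inl 0) (Sum.inr tl) (by decide)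
      have b := Relation.EqvGen.trans _ _ _ a (v (Sum.inr tl) (Sum.inr bl) (by decide))
      have c := Relation.EqvGen.trans _ _ _ h01 (v (Sum.inl 1) (Sum.inr br) (by decide))
      have d := Relation.EqvGen.trans _ _ _ c (v (Sum.inr br) (Sum.inr tr) (by decide))
      rintro (x | x | x) <;> fin_cases x
      · exact Relation.EqvGen.refl _
      · exact h01
      · exact a
      · exact d
      · exact b
      · exact c
    exact fun x y => Relation.EqvGen.trans _ _ _ (Relation.EqvGen.symm _ _ (h x)) (h y)

/-- The ladder with `n` rungs, for `n ≥ 1`, drawn upright in the plane. The two upper ends are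
`tl`, `tr`, the two lower ends are `bl`, `br`. (The value at `n = 0` has no meaning.) -/
def ladder : ℕ → Piece Ends
  | 0 => rung
  | 1 => rung
  | n + 2 => (ladder (n + 1)).glue rung

/-- Exchanges the two upper ends and exchanges the two lower ends: every end of a ladder is sent
to the neighbouring end. -/
def neighbour : Equiv.Perm Ends := Equiv.sumCongr (Equiv.swap 0 1) (Equiv.swap 0 1)

/-- Renames the ends such that the ends on the left become the first pair and the ends on the right
become the second pair, from top to bottom. It is an involution. -/
def sideways : Equiv.Perm Ends := Equiv.swap tr bl

/-- A rotation of the plane by a right angle, counter-clockwise. -/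
def quarterTurn : Equiv.Perm Ends where
  toFun
    | Sum.inl 0 => bl
    | Sum.inr 0 => br
    | Sum.inr 1 => tr
    | Sum.inl 1 => tl
  invFun
    | Sum.inl 0 => tr
    | Sum.inr 0 => tl
    | Sum.inr 1 => bl
    | Sum.inl 1 => br
  left_inv := by decide
  right_inv := by decide

/-- The piece of relation (x): the `n` rungs of a ladder join its left strand to its right strand,
which is closed to a loop by one further trivalent vertex. -/
def xPiece (n : ℕ) : Piece (Fin 2 ⊕ Fin 1) :=
  ((ladder n).rename sideways).glue (tripod.rename (finSumFinEquiv (m := 2) (n := 1)).symm)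

/-- The relations that hold in `BHat u`: isomorphic diagrams are identified, and the local
relations (AS), (IHX) and (x) hold at every place of every diagram. -/
inductive IsRelation {k : ℕ} (u : Fin k → ℕ) : (Diagram u →₀ ℚ) → Prop
  | iso (D D' : Diagram u) (f : D.Iso D') :
      IsRelation u (Finsupp.single D 1 - Finsupp.single D' 1)
  /-- (AS): reversing the cyclic ordering at a vertex changes the sign. -/
  | antisymmetry (C : Rest (Fin 3) u) :
      IsRelation u (Finsupp.single (C.fill tripod) 1
        + Finsupp.single (C.fill (tripod.rename (Equiv.swap 0 1))) 1)
  /-- (IHX): I = H - X, where I is a rotated H and X is an H with crossed lower ends. -/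
  | ihx (C : Rest Ends u) :
      IsRelation u (Finsupp.single (C.fill (rung.rename quarterTurn)) 1
        - (Finsupp.single (C.fill rung) 1
          - Finsupp.single (C.fill (rung.rename (Equiv.swap bl br))) 1))
  /-- (x): a diagram containing one of the pieces `xPiece n` vanishes. -/
  | x (n : ℕ) (hn : 1 ≤ n) (C : Rest (Fin 2 ⊕ Fin 1) u) :
      IsRelation u (Finsupp.single (C.fill (xPiece n)) 1)

/-- The rational vector space of `u`-coloured diagrams modulo (AS), (IHX) and (x). -/
abbrev BHat {k : ℕ} (u : Fin k → ℕ) : Type 1 :=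
  (Diagram u →₀ ℚ) ⧸ Submodule.span ℚ {r | IsRelation u r}

/-- The element of `BHat u` represented by the diagram that consists of `P` and `C`. -/
noncomputable def Rest.value {B : Type} [Finite B] {k : ℕ} {u : Fin k → ℕ} (C : Rest B u)
    (P : Piece B) : BHat u :=
  Submodule.Quotient.mk (Finsupp.single (C.fill P) 1)

/-! Label the edges of a diagram and write a piece as a product of commuting symbols `f a b c`, one
for each trivalent vertex. This is tensor notation: a label occurring twice is a dummy index and may
be renamed. Formal sums of such products, modulo those that vanish in every completion to a diagram,
form a commutative ℚ-algebra, so local relations become equations that can be multiplied and added.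
The theorem thus reduces to computations in a `NetAlgebra`, where (AS), (IHX), (x) and the renaming
of inner edges are axioms.

The main tool is `kirchhoff`: by (IHX), the sum of all ways to attach an edge to the four ends of a
ladder vanishes. The one-rung case of (x) kills double edges, hence triangles (`triangle`), and then
(IHX) makes a square symmetric in its four ends. Now let a ladder with an even number of rungs be
symmetric. With one more rung its value depends only on the pairing of the ends, and by `kirchhoff`
the three pairings add up to zero; this is (LIHX). Glue a further rung to two ends: of the three
pairings, the two in which these ends are not neighbours agree, because (IHX) uncrosses the rung up
to a term that (x) kills; hence the factor -1/2 in (LI) (`ext_across`). Inserting (LI) into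
`kirchhoff` for the odd ladder shows that twice the value of one pairing is the sum of the other
two. So all three agree, the ladder with two more rungs is symmetric, and (LS) follows by induction
in steps of two.

For (LL) (`parallel`), (IHX) on one of the two connecting strands and several applications of
`kirchhoff` rewrite the parallel ladders as a stack in which two consecutive gluings are made
across, each contributing a factor -1/2. The remaining terms vanish by `tripod_eq_zero`,
`theta_eq_zero` and `ext_stack_loop`. -/

/-! ### Nets: products of labelled trivalent vertices. -/

/-- The two vertices of a rung `r` between a strand from `a` to `c` and a strand from `b` to `d`. -/
def rungNet {X : Type*} (a b c d r : X) : List (X × X × X) := [(r, a, c), (r, d, b)]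

/-- The vertices of a ladder with ends `a`, `b` (top) and `c`, `d` (bottom). Its topmost rung is
`r`; every entry of the list describes two strand segments and the rung below them, and the head
of the list belongs to the lowest rung. -/
def ladderNet {X : Type*} (r : X) : List (X × X × X) → X → X → X → X → List (X × X × X)
  | [], a, b, c, d => rungNet a b c d r
  | (m, m', r') :: ls, a, b, c, d => ladderNet r ls a b m m' ++ rungNet m m' c d r'

/-- The product of the vertex weights of a net. -/
def netProd {L A : Type*} [CommRing A] (f : L → L → L → A) (s : List (L × L × L)) : A :=
  (s.map fun t => f t.1 t.2.1 t.2.2).prod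

/-- The labels of the half-edges of a net. -/
def netLabels {X : Type*} (s : List (X × X × X)) : List X :=
  s.flatMap fun t => [t.1, t.2.1, t.2.2]

/-- Applies a map to the labels of a net. -/
def netMap {X Y : Type*} (ψ : X → Y) (s : List (X × X × X)) : List (Y × Y × Y) :=
  s.map (Prod.map ψ (Prod.map ψ ψ))

/-- An algebra of trivalent nets with labelled edges, in which the local relations hold. -/
structure NetAlgebra (L A : Type*) [CommRing A] [Algebra ℚ A] where
  f : L → L → L → A
  rot : ∀ a b c, f a b c = f b c a
  anti : ∀ a b c, f a b c = -f b a c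
  ihx : ∀ e a b c d, f e a b * f e c d + f e b c * f e a d + f e c a * f e b d = 0
  loop : ∀ r ls a c e e' z, netProd f (ladderNet r ls a e c e') * f e e' z = 0
  -- Two occurrences inside `s` make a label an inner edge, that is, a dummy index. Since `ψ` need
  -- not be injective, the rule also covers formal indices that happen to carry equal labels.
  relabel : ∀ {X : Type} [DecidableEq X] (ψ : X → L) (τ : Equiv.Perm X) (s : List (X × X × X)),
    (∀ x, τ x ≠ x → 2 ≤ (netLabels s).countP (· = x)) →
    netProd f (netMap ψ s) = netProd f (netMap (ψ ∘ τ) s)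

/-- A trivalent vertex or a named four-legged subnet of a net. -/
inductive Atom (X κ : Type)
  | tri (a b c : X)
  | leg (i : κ) (a b c d : X)

def Atom.labels {X κ : Type} : Atom X κ → List X
  | .tri a b c => [a, b, c]
  | .leg _ a b c d => [a, b, c, d]

theorem netProd_append {L A : Type*} [CommRing A] (f : L → L → L → A) (s t : List (L × L × L)) :
    netProd f (s ++ t) = netProd f s * netProd f t := by
  simp [netProd]

theorem ladderNet_map {X Y : Type*} (ψ : X → Y) (r : X) (ls : List (X × X × X)) (a b c d : X) :
    netMap ψ (ladderNet r ls a b c d) =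
      ladderNet (ψ r) (netMap ψ ls) (ψ a) (ψ b) (ψ c) (ψ d) := by
  induction ls generalizing c d with
  | nil => simp [ladderNet, rungNet, netMap]
  | cons h t ih =>
    obtain ⟨m, m', r'⟩ := h
    have := ih m m'
    simp only [netMap] at this
    simp [ladderNet, rungNet, netMap, this]

theorem ladderNet_countP {X : Type*} [DecidableEq X] (x : X) (r : X) (ls : List (X × X × X))
    (a b c d : X) :
    [a, b, c, d].countP (· = x) ≤ (netLabels (ladderNet r ls a b c d)).countP (· = x) := by
  induction ls generalizing c d with
  | nil =>
    simp only [netLabels, ladderNet, rungNet, List.flatMap_cons, List.flatMap_nil, List.cons_append,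
      List.nil_append, List.append_nil, List.countP_cons, List.countP_nil]
    omega
  | cons h t ih =>
    obtain ⟨m, m', r'⟩ := h
    have := ih m m'
    simp only [netLabels, ladderNet, rungNet, List.flatMap_append, List.flatMap_cons,
      List.flatMap_nil, List.cons_append, List.nil_append, List.append_nil, List.countP_append,
      List.countP_cons, List.countP_nil] at this ⊢
    omega

/-! ### Ladders with one and two additional rungs, and the symmetry of even ladders. -/

namespace NetAlgebra

variable {L : Type} {A : Type*} [CommRing A] [Algebra ℚ A] (Γ : NetAlgebra L A)

/-- The weight of a ladder. -/
def lad (D : L × List (L × L × L)) (a b c d : L) : A := netProd Γ.f (ladderNet D.1 D.2 a b c d)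

/-- The vertices of an atom, with the labels of the subnets kept apart. -/
def expand {k : ℕ} {κ : Type} (D : κ → L × List (L × L × L)) :
    Atom (Fin k) κ → List ((Fin k ⊕ L) × (Fin k ⊕ L) × (Fin k ⊕ L))
  | .tri a b c => [(.inl a, .inl b, .inl c)]
  | .leg i a b c d =>
    ladderNet (.inr (D i).1) (netMap .inr (D i).2) (.inl a) (.inl b) (.inl c) (.inl d)

/-- The weight of an atom. -/
def weight {X κ : Type} (D : κ → L × List (L × L × L)) (ψ : X → L) : Atom X κ → A
  | .tri a b c => Γ.f (ψ a) (ψ b) (ψ c)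
  | .leg i a b c d => Γ.lad (D i) (ψ a) (ψ b) (ψ c) (ψ d)

theorem netMap_netMap {X Y Z : Type*} (φ : Y → Z) (ψ : X → Y) (s : List (X × X × X)) :
    netMap φ (netMap ψ s) = netMap (φ ∘ ψ) s := by
  simp [netMap, Function.comp_def, Prod.map]

theorem netMap_id {X : Type*} (s : List (X × X × X)) : netMap id s = s := by
  simp [netMap]

theorem three_cancel {A : Type*} [CommRing A] [Algebra ℚ A] {x : A} (h : 3 * x = 0) : x = 0 := by
  have h' : (3 : ℚ) • x = 0 := by rw [Algebra.smul_def, map_ofNat, h]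
  exact (smul_eq_zero_iff_right three_ne_zero).1 h'

theorem prod_weight {k : ℕ} {κ : Type} (D : κ → L × List (L × L × L)) (ψ : Fin k → L)
    (l : List (Atom (Fin k) κ)) :
    (l.map (Γ.weight D ψ)).prod = netProd Γ.f (netMap (Sum.elim ψ id) (l.flatMap (expand D))) := by
  induction l with
  | nil => simp [netProd, netMap]
  | cons x l ih =>
    rw [List.map_cons, List.prod_cons, ih, List.flatMap_cons]
    rw [netMap, netMap, List.map_append, netProd_append]
    congr 1
    cases x with
    | tri a b c => simp [weight, expand, netProd]
    | leg i a b c d =>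
      rw [weight, expand, ← netMap, ladderNet_map, netMap_netMap, lad]
      simp [Function.comp_def]
      rw [← Function.id_def, netMap_id]

theorem countP_expand {k : ℕ} {κ : Type} [DecidableEq L] (D : κ → L × List (L × L × L))
    (x : Fin k) (l : List (Atom (Fin k) κ)) :
    (l.flatMap Atom.labels).countP (· = x) ≤
      (netLabels (l.flatMap (expand D))).countP (· = Sum.inl x) := by
  induction l with
  | nil => simp
  | cons y l ih =>
    simp only [netLabels, List.flatMap_cons, List.flatMap_append, List.countP_append] at ih ⊢
    refine Nat.add_le_add ?_ ih
    cases y with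
    | tri a b c => simp [expand, Atom.labels, List.countP_cons]
    | leg i a b c d =>
      refine le_trans ?_ (ladderNet_countP _ _ _ _ _ _ _)
      simp [Atom.labels, List.countP_cons]

/-- A ladder of any length counts as a single atom with four legs, its inner labels being kept apart
in the summand `L`. So the condition on `τ` concerns a short explicit list and can be decided. -/
theorem relabel_atoms {k : ℕ} {κ : Type} (D : κ → L × List (L × L × L)) (ψ : Fin k → L)
    (τ : Equiv.Perm (Fin k)) (l : List (Atom (Fin k) κ))
    (h : ∀ x, τ x ≠ x → 2 ≤ (l.flatMap Atom.labels).countP (· = x)) :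
    (l.map (Γ.weight D ψ)).prod = (l.map (Γ.weight D (ψ ∘ τ))).prod := by
  classical
  rw [prod_weight, prod_weight]
  have := Γ.relabel (Sum.elim ψ id) (Equiv.sumCongr τ (Equiv.refl L)) (l.flatMap (expand D)) (by
    rintro (x | x) hx
    · exact (h x (by simpa using hx)).trans (countP_expand D x l)
    · exact absurd rfl hx)
  rw [this]
  congr 2
  ext (x | x) <;> rfl

theorem f_left (a b c : L) : Γ.f a b c = -Γ.f a c b := by
  rw [Γ.anti, Γ.rot b a c]

theorem f_right (a b c : L) : Γ.f a b c = Γ.f c a b := (Γ.rot c a b).symm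

theorem f_rev (a b c : L) : Γ.f a b c = -Γ.f c b a := by
  rw [Γ.anti, Γ.rot b a c, Γ.rot a c b]

theorem two_cancel {A : Type*} [CommRing A] [Algebra ℚ A] {x : A} (h : 2 * x = 0) : x = 0 := by
  have h' : (2 : ℚ) • x = 0 := by rw [Algebra.smul_def, map_ofNat, h]
  exact (smul_eq_zero_iff_right two_ne_zero).1 h'

theorem lad_nil (r a b c d : L) : Γ.lad (r, []) a b c d = Γ.f r a c * Γ.f r d b := by
  simp [lad, ladderNet, rungNet, netProd]

theorem lad_cons (r m m' r' a b c d : L) (ls : List (L × L × L)) :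
    Γ.lad (r, (m, m', r') :: ls) a b c d =
      Γ.lad (r, ls) a b m m' * (Γ.f r' m c * Γ.f r' d m') := by
  simp only [lad, ladderNet, netProd_append]
  simp [rungNet, netProd]

/-- The sign arises because the two vertices of a rung are read in opposite senses along the strands
in `rungNet`, but in the same sense here and in `ext`. -/
theorem lad_cons' (D : L × List (L × L × L)) (m m' r' a b c d : L) :
    Γ.lad (D.1, (m, m', r') :: D.2) a b c d =
      - (Γ.lad D a b m m' * (Γ.f m r' c * Γ.f m' r' d)) := by
  obtain ⟨r, ls⟩ := D
  rw [lad_cons, Γ.anti r' m c, Γ.rot r' d m', Γ.rot d m' r']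
  ring

theorem lad_loop (D : L × List (L × L × L)) (a c e e' z : L) :
    Γ.lad D a e c e' * Γ.f e e' z = 0 := Γ.loop _ _ _ _ _ _ _

/-- Relation (x) with one rung. The factor `f r a c` is the vertex on the strand: a double edge is
only known to vanish next to a trivalent vertex. -/
theorem bubble (r a c e e' z : L) : Γ.f r a c * (Γ.f r e e' * Γ.f z e e') = 0 := by
  have h := Γ.lad_loop (r, []) a c e e' z
  rw [lad_nil, Γ.f_left r e' e, Γ.f_right e e' z] at h
  linear_combination -h

/-- Apply (IHX) to the side `x`. One term contains a double edge; the other two are both the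
triangle, since exchanging `y` and `z` identifies them. -/
theorem triangle (a b c x y z : L) : Γ.f a x y * Γ.f b y z * Γ.f c z x = 0 := by
  have h1 := Γ.ihx x a y z c
  have h2 := Γ.bubble x a c y z b
  have h3 := Γ.relabel_atoms (κ := Empty) Empty.elim ![a, b, c, x, y, z] (Equiv.swap 4 5)
    [.tri 0 3 4, .tri 1 4 5, .tri 2 5 3] (by decide)
  simp [weight, Equiv.swap_apply_def] at h3
  have e1 : Γ.f x a y = -Γ.f a x y := Γ.anti _ _ _
  have e2 : Γ.f x z c = -Γ.f c z x := Γ.f_rev _ _ _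
  have e3 : Γ.f x z a = Γ.f a x z := Γ.f_right _ _ _
  have e4 : Γ.f x y c = -Γ.f c y x := Γ.f_rev _ _ _
  have e5 : Γ.f b z y = -Γ.f b y z := Γ.f_left _ _ _
  rw [e1, e2, e3, e4] at h1
  rw [e5] at h3
  refine two_cancel ?_
  linear_combination Γ.f b y z * h1 - h2 + h3

theorem kirchhoff_tri (e p x y z : L) :
    Γ.f e p x * Γ.f e y z + Γ.f e p y * Γ.f x e z + Γ.f e p z * Γ.f x y e = 0 := by
  have h := Γ.ihx e p x y z
  rw [Γ.f_left e y p, Γ.anti e x z, Γ.rot e x y] at h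
  linear_combination h

/-- The law holds at each vertex. The two contributions on the rung itself differ by exchanging `e`
and `r`, which reverses one vertex, so they cancel. -/
theorem kirchhoff_rung (r e p a b c d : L) :
    Γ.f e p a * Γ.lad (r, []) e b c d + Γ.f e p b * Γ.lad (r, []) a e c d +
      Γ.f e p c * Γ.lad (r, []) a b e d + Γ.f e p d * Γ.lad (r, []) a b c e = 0 := by
  have h1 := Γ.kirchhoff_tri e p r a c
  have h2 := Γ.kirchhoff_tri e p r d b
  have h3 := Γ.relabel_atoms (κ := Empty) Empty.elim ![a, b, c, d, p, e, r] (Equiv.swap 5 6)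
    [.tri 5 4 6, .tri 5 0 2, .tri 6 3 1] (by decide)
  simp [weight, Equiv.swap_apply_def] at h3
  rw [Γ.f_rev r p e] at h3
  simp only [lad_nil]
  linear_combination Γ.f r d b * h1 + Γ.f r a c * h2 - h3

/-- The sum over all ways to attach an edge `p` to an end of a ladder vanishes. -/
theorem kirchhoff (D : L × List (L × L × L)) (e p a b c d : L) :
    Γ.f e p a * Γ.lad D e b c d + Γ.f e p b * Γ.lad D a e c d +
      Γ.f e p c * Γ.lad D a b e d + Γ.f e p d * Γ.lad D a b c e = 0 := by
  obtain ⟨r, ls⟩ := D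
  induction ls generalizing c d with
  | nil => exact Γ.kirchhoff_rung r e p a b c d
  | cons h ls ih =>
    obtain ⟨m, m', r'⟩ := h
    have h1 := ih m m'
    have h2 := Γ.kirchhoff_rung r' e p m m' c d
    -- The contributions on the strands `m` and `m'` between the upper ladder and the last rung
    -- cancel in the same way.
    have h3 := Γ.relabel_atoms (κ := Bool) (fun i => bif i then (r, ls) else (r', []))
      ![a, b, c, d, p, e, m, m'] (Equiv.swap 5 6)
      [.tri 5 4 6, .leg true 0 1 5 7, .leg false 6 7 2 3] (by decide)
    have h4 := Γ.relabel_atoms (κ := Bool) (fun i => bif i then (r, ls) else (r', []))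
      ![a, b, c, d, p, e, m, m'] (Equiv.swap 5 7)
      [.tri 5 4 7, .leg true 0 1 6 5, .leg false 6 7 2 3] (by decide)
    simp [weight, Equiv.swap_apply_def] at h3 h4
    rw [Γ.f_rev m p e] at h3
    rw [Γ.f_rev m' p e] at h4
    simp only [lad_cons, lad_nil] at h2 h3 h4 ⊢
    linear_combination Γ.f r' m c * Γ.f r' d m' * h1 + Γ.lad (r, ls) a b m m' * h2 - h3 - h4

/-- A property of ladders with an even number of rungs. -/
def Symmetric (D : L × List (L × L × L)) : Prop :=
  ∀ a b c d, Γ.lad D a b c d = Γ.lad D b a c d ∧ Γ.lad D a b c d = Γ.lad D a c b d ∧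
    Γ.lad D a b c d = Γ.lad D a b d c

/-- The top left vertex of the ladder is the trivalent vertex that `bubble` needs. -/
theorem bubble_lad (D : L × List (L × L × L)) (e p e' a b c d : L) :
    Γ.lad D e b c d * (Γ.f e p e' * Γ.f e' p a) = 0 := by
  obtain ⟨r, ls⟩ := D
  induction ls generalizing c d with
  | nil =>
    have := Γ.bubble e c r p e' a
    rw [Γ.f_right a, Γ.f_left e' a p] at this
    rw [lad_nil, Γ.rot r]
    linear_combination (-Γ.f r d b) * this
  | cons h ls ih =>
    obtain ⟨m, m', r'⟩ := h
    have := ih m m'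
    rw [lad_cons]
    linear_combination (Γ.f r' m c * Γ.f r' d m') * this

/-- The ladder `D` with a rung glued to its first two ends. -/
def ext (D : L × List (L × L × L)) (e e' r a b c d : L) : A :=
  Γ.lad D e e' c d * (Γ.f e r a * Γ.f e' r b)

/-- The sum over all ways to join an end to another end by a rung vanishes. -/
theorem ext_sum' (D : L × List (L × L × L)) (e e' r a b c d : L) :
    Γ.ext D e e' r a b c d + Γ.lad D e b e' d * (Γ.f e r a * Γ.f e' r c) +
      Γ.lad D e b c e' * (Γ.f e r a * Γ.f e' r d) = 0 := by
  -- The edge `r` starts on the leg from `e` to `a`. Attaching its other end to this same leg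
  -- creates a double edge.
  have h1 := Γ.kirchhoff D e' r e b c d
  have h2 := Γ.bubble_lad D e' r e a b c d
  rw [ext]
  linear_combination Γ.f e r a * h1 - h2

namespace Symmetric

variable {Γ} {D : L × List (L × L × L)}
theorem swap₁ (h : Γ.Symmetric D) (a b c d : L) : Γ.lad D a b c d = Γ.lad D b a c d := (h a b c d).1

theorem swap₂ (h : Γ.Symmetric D) (a b c d : L) : Γ.lad D a b c d = Γ.lad D a c b d :=
  (h a b c d).2.1

theorem swap₃ (h : Γ.Symmetric D) (a b c d : L) : Γ.lad D a b c d = Γ.lad D a b d c :=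
  (h a b c d).2.2

theorem flip (h : Γ.Symmetric D) (a b c d : L) : Γ.lad D a b c d = Γ.lad D c d a b := by
  rw [h.swap₂ a b c d, h.swap₁ a c b d, h.swap₃ c a b d, h.swap₂ c a d b]

/-- Exchanging the names of `e` and `e'` crosses the new ends, and the symmetry of `D` undoes the
exchange on the ladder. -/
theorem ext_comm_left (h : Γ.Symmetric D) (e e' r a b c d : L) :
    Γ.ext D e e' r a b c d = Γ.ext D e e' r b a c d := by
  have h1 := Γ.relabel_atoms (κ := Unit) (fun _ => D)
      ![a, b, c, d, e, e', r] (Equiv.swap 4 5)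
      [.tri 4 6 0, .tri 5 6 1, .leg () 4 5 2 3] (by decide)
  simp [weight, Equiv.swap_apply_def] at h1
  rw [ext, ext]
  rw [← h.swap₁ e e' c d] at h1
  linear_combination h1

theorem ext_comm_right (h : Γ.Symmetric D) (e e' r a b c d : L) :
    Γ.ext D e e' r a b c d = Γ.ext D e e' r a b d c := by
  rw [ext, ext, h.swap₃]

theorem ext_sum (h : Γ.Symmetric D) (e e' r a b c d : L) :
    Γ.ext D e e' r a b c d + Γ.ext D e e' r a c b d + Γ.ext D e e' r a d b c = 0 := by
  have h1 := Γ.ext_sum' D e e' r a b c d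
  rw [h.swap₂ e b e' d, h.swap₃ e b c e', h.swap₂ e b e' c] at h1
  simp only [ext] at h1 ⊢
  linear_combination h1

/-- Write `[ab]` for the value with the rung at `a`, `b`, and `S_a` for the relation `[ab] + [ac] +
[ad] = 0`. Then `S_a + S_b - S_c - S_d` is `2[ab] - 2[cd] = 0`. -/
theorem ext_flip (h : Γ.Symmetric D) (e e' r a b c d : L) :
    Γ.ext D e e' r a b c d = Γ.ext D e e' r c d a b := by
  have h1 := h.ext_sum e e' r a b c d
  have h2 := h.ext_sum e e' r b a c d
  have h3 := h.ext_sum e e' r c d a b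
  have h4 := h.ext_sum e e' r d c a b
  rw [h.ext_comm_left e e' r b a c d, h.ext_comm_right e e' r b c a d,
    h.ext_comm_right e e' r b d a c] at h2
  rw [h.ext_comm_left e e' r c a d b, h.ext_comm_right e e' r a c d b,
    h.ext_comm_left e e' r c b d a, h.ext_comm_right e e' r b c d a] at h3
  rw [h.ext_comm_left e e' r d c a b, h.ext_comm_left e e' r d a c b,
    h.ext_comm_right e e' r a d c b, h.ext_comm_left e e' r d b c a,
    h.ext_comm_right e e' r b d c a] at h4
  refine sub_eq_zero.1 (two_cancel ?_)
  linear_combination h1 + h2 - h3 - h4 + h.ext_comm_right e e' r b c a d +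
    h.ext_comm_right e e' r b d a c

theorem lad_cons (h : Γ.Symmetric D) (m m' r a b c d : L) :
    Γ.lad (D.1, (m, m', r) :: D.2) a b c d = - Γ.ext D m m' r a b c d := by
  rw [h.ext_flip, lad_cons', ext, h.flip a b]

theorem ext_loop (h : Γ.Symmetric D) (e e' r x y z c d : L) :
    Γ.ext D e e' r x c y d * Γ.f x y z = 0 := by
  have h1 := Γ.lad_loop (D.1, (e, e', r) :: D.2) c d x y z
  rw [h.lad_cons, h.ext_comm_left, h.ext_comm_right] at h1
  linear_combination -h1

end Symmetric

/-- The ladder `D` with two rungs glued to its first two ends. -/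
def ext₂ (D : L × List (L × L × L)) (e e' r x y s a b c d : L) : A :=
  Γ.ext D e e' r x y c d * (Γ.f x s a * Γ.f y s b)

namespace Symmetric

variable {Γ} {D : L × List (L × L × L)}

/-- A rung glued to two ends of an odd ladder that are not neighbouring. -/
theorem ext_across (h : Γ.Symmetric D) (e e' r x y s a b c d : L) :
    2 * (Γ.ext D e e' r x c y d * (Γ.f x s a * Γ.f y s b)) = -Γ.ext₂ D e e' r x y s a b c d := by
  -- Multiply the sum over the three pairings of `x, y, c, d` by the rung `s`. The pairing of `x`
  -- with `y` gives `ext₂`; the other two differ by crossing the rung. By (IHX) on `s`, uncrossing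
  -- costs a term in which `x` and `y` meet at a vertex, and `h3` kills it.
  have h1 := h.ext_sum e e' r x y c d
  have h2 := Γ.relabel_atoms (κ := Unit) (fun _ => D)
      ![a, b, c, d, e, e', r, x, y, s] (Equiv.swap 7 8)
      [.leg () 4 5 8 3, .tri 4 6 7, .tri 5 6 2, .tri 7 9 1, .tri 8 9 0] (by decide)
  simp [weight, Equiv.swap_apply_def] at h2
  have h3 := h.ext_loop e e' r x y s c d
  have h4 := Γ.ihx s a x b y
  rw [← Γ.rot x s a, ← Γ.rot y s b, ← Γ.rot y s a, Γ.f_left s x b, ← Γ.rot x s b,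
    Γ.rot s x y] at h4
  have h5 : Γ.ext D e e' r x c y d * (Γ.f x s b * Γ.f y s a) =
      Γ.ext D e e' r x d y c * (Γ.f x s a * Γ.f y s b) := by
    rw [h.ext_flip e e' r x d, ext, ext]
    linear_combination h2
  rw [ext₂]
  linear_combination (Γ.f x s a * Γ.f y s b) * h1 + Γ.ext D e e' r x c y d * h4 +
    h5 - Γ.f s b a * h3

theorem ext₂_comm_left (h : Γ.Symmetric D) (e e' r x y s a b c d : L) :
    Γ.ext₂ D e e' r x y s a b c d = Γ.ext₂ D e e' r x y s b a c d := by
  have h2 := Γ.relabel_atoms (κ := Unit) (fun _ => D)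
      ![a, b, c, d, e, e', r, x, y, s] (Equiv.swap 7 8)
      [.leg () 4 5 2 3, .tri 4 6 7, .tri 5 6 8, .tri 7 9 0, .tri 8 9 1] (by decide)
  simp [weight, Equiv.swap_apply_def] at h2
  have h3 := h.ext_comm_left e e' r y x c d
  simp only [ext₂, ext] at h3 ⊢
  linear_combination h2 + Γ.f x s b * Γ.f y s a * h3

theorem ext₂_comm_right (h : Γ.Symmetric D) (e e' r x y s a b c d : L) :
    Γ.ext₂ D e e' r x y s a b c d = Γ.ext₂ D e e' r x y s a b d c := by
  rw [ext₂, ext₂, h.ext_comm_right]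

/-- This is `ext_sum'` for the ladder that already has the rung `r`: in two of its terms the rung
`s` joins ends that are not neighbouring, and `ext_across` replaces each by half of an `ext₂`. -/
theorem ext₂_sum (h : Γ.Symmetric D) (e e' r x y s a b c d : L) :
    2 * Γ.ext₂ D e e' r x y s a b c d =
      Γ.ext₂ D e e' r x y s a c b d + Γ.ext₂ D e e' r x y s a d b c := by
  have h1 := Γ.ext_sum' (D.1, (e, e', r) :: D.2) x y s a b c d
  rw [ext, h.lad_cons, h.lad_cons, h.lad_cons, h.ext_comm_right e e' r x b c y] at h1
  have h2 := h.ext_across e e' r x y s a c b d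
  have h3 := h.ext_across e e' r x y s a d b c
  rw [ext₂]
  linear_combination (-2 : A) * h1 - h2 - h3

/-- The difference of two instances of `ext₂_sum` is three times the difference of the two sides. -/
theorem ext₂_comm_middle (h : Γ.Symmetric D) (e e' r x y s a b c d : L) :
    Γ.ext₂ D e e' r x y s a b c d = Γ.ext₂ D e e' r x y s a c b d := by
  have h1 := h.ext₂_sum e e' r x y s a b c d
  have h2 := h.ext₂_sum e e' r x y s a c b d
  rw [h.ext₂_comm_right _ _ _ _ _ _ a d c b] at h2
  refine sub_eq_zero.1 (three_cancel ?_)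
  linear_combination h1 - h2

theorem lad_cons_cons (h : Γ.Symmetric D) (e e' r x y s a b c d : L) :
    Γ.lad (D.1, (x, y, s) :: (e, e', r) :: D.2) a b c d = Γ.ext₂ D e e' r x y s c d a b := by
  have := Γ.lad_cons' (D.1, (e, e', r) :: D.2) x y s a b c d
  rw [h.lad_cons, h.ext_flip] at this
  rw [this, ext₂]
  ring

theorem cons_cons (h : Γ.Symmetric D) (e e' r x y s : L) :
    Γ.Symmetric (D.1, (x, y, s) :: (e, e', r) :: D.2) := by
  intro a b c d
  simp only [h.lad_cons_cons]
  refine ⟨h.ext₂_comm_right _ _ _ _ _ _ _ _ _ _, ?_, h.ext₂_comm_left _ _ _ _ _ _ _ _ _ _⟩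
  rw [h.ext₂_comm_left _ _ _ _ _ _ c d, h.ext₂_comm_right _ _ _ _ _ _ d c,
    h.ext₂_comm_middle _ _ _ _ _ _ d c b a, h.ext₂_comm_left _ _ _ _ _ _ d b,
    h.ext₂_comm_right _ _ _ _ _ _ b d]

end Symmetric

/-- A square is symmetric in its four ends. -/
theorem symmetric_square (r m m' s : L) : Γ.Symmetric (r, [(m, m', s)]) := by
  intro a b c d
  have key : ∀ a b c d, Γ.lad (r, [(m, m', s)]) a b c d =
      Γ.f r a m * Γ.f r m' b * (Γ.f s m c * Γ.f s d m') := fun a b c d => by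
    rw [lad_cons, lad_nil]
  have h3 : ∀ a b c d, Γ.lad (r, [(m, m', s)]) a b c d = Γ.lad (r, [(m, m', s)]) a b d c := by
    intro a b c d
    -- By (IHX) on the lower side `s`, crossing the lower ends changes the square by a term
    -- containing a triangle.
    have h1 := Γ.ihx s m c d m'
    have h4 := Γ.triangle a b s m r m'
    rw [Γ.f_left s d m] at h1
    rw [← Γ.rot r a m, ← Γ.f_right r m' b, Γ.f_left s m' m] at h4
    rw [key, key]
    linear_combination Γ.f r a m * Γ.f r m' b * h1 + Γ.f s c d * h4
  have h1 : ∀ a b c d, Γ.lad (r, [(m, m', s)]) a b c d = Γ.lad (r, [(m, m', s)]) c a d b := by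
    intro a b c d
    have h2 := Γ.relabel_atoms (κ := Empty) Empty.elim
      ![a, b, c, d, r, m, m', s] (c[4, 6, 7, 5])
      -- The 4-cycle `r → m' → s → m → r` of the sides is a quarter turn of the square. Together
      -- with the transposition in `h3` it yields the required symmetries.
      [.tri 4 0 5, .tri 4 6 1, .tri 7 5 2, .tri 7 3 6] (by decide)
    simp only [weight, List.map_cons, List.map_nil, List.prod_cons, List.prod_nil,
      Function.comp_apply, show (c[4, 6, 7, 5] : Equiv.Perm (Fin 8)) 0 = 0 by decide,
      show (c[4, 6, 7, 5] : Equiv.Perm (Fin 8)) 1 = 1 by decide,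
      show (c[4, 6, 7, 5] : Equiv.Perm (Fin 8)) 2 = 2 by decide,
      show (c[4, 6, 7, 5] : Equiv.Perm (Fin 8)) 3 = 3 by decide,
      show (c[4, 6, 7, 5] : Equiv.Perm (Fin 8)) 4 = 6 by decide,
      show (c[4, 6, 7, 5] : Equiv.Perm (Fin 8)) 5 = 4 by decide,
      show (c[4, 6, 7, 5] : Equiv.Perm (Fin 8)) 6 = 7 by decide,
      show (c[4, 6, 7, 5] : Equiv.Perm (Fin 8)) 7 = 5 by decide] at h2
    simp at h2
    rw [key, key]
    rw [Γ.rot m' s b, Γ.rot m r c, Γ.f_right m d s, ← Γ.rot r m' a] at h2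
    linear_combination h2
  have h2 : ∀ a b c d, Γ.lad (r, [(m, m', s)]) a b c d = Γ.lad (r, [(m, m', s)]) b a c d := by
    intro a b c d
    rw [h1 a b, h1 c a, h3, h1, h1]
  exact ⟨h2 _ _ _ _, by rw [h1, h3, h2], h3 _ _ _ _⟩

/-- A ladder with an even number of rungs is symmetric in its four ends. -/
theorem symmetric_of_odd (r : L) (ls : List (L × L × L)) (h : Odd ls.length) :
    Γ.Symmetric (r, ls) := by
  induction ls using List.twoStepInduction with
  | nil => simp at h
  | singleton x => exact Γ.symmetric_square r x.1 x.2.1 x.2.2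
  | cons_cons x y ls ih _ =>
    have : Odd ls.length := by
      simpa [Nat.odd_add_one, parity_simps] using h
    exact (ih this).cons_cons y.1 y.2.1 y.2.2 x.1 x.2.1 x.2.2

end NetAlgebra

/-! ### Stacked ladders and ladders in parallel. -/

namespace NetAlgebra

variable {L : Type} {A : Type*} [CommRing A] [Algebra ℚ A] {Γ : NetAlgebra L A}

/-- The ladder `E` glued below the ladder `D`, along strands labelled `m` and `m'`. -/
def stack (D E : L × List (L × L × L)) (m m' : L) : L × List (L × L × L) :=
  (D.1, E.2 ++ (m, m', E.1) :: D.2)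

theorem lad_stack (D E : L × List (L × L × L)) (m m' a b c d : L) :
    Γ.lad (stack D E m m') a b c d = Γ.lad D a b m m' * Γ.lad E m m' c d := by
  obtain ⟨r, ls⟩ := D
  obtain ⟨s, ks⟩ := E
  rw [stack]
  induction ks generalizing c d with
  | nil => rw [List.nil_append, lad_cons, lad_nil]
  | cons h ks ih =>
    obtain ⟨n, n', t⟩ := h
    simp only [List.cons_append, lad_cons] at ih ⊢
    rw [ih]
    ring

/-- A ladder with an odd number of rungs, glued to a ladder with an even number of rungs along two
ends that are not neighbouring. -/
theorem ext_stack {T S : L × List (L × L × L)} (hT : Γ.Symmetric T) (hS : Γ.Symmetric S)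
    (e e' r x y a b c d : L) :
    2 * (Γ.ext T e e' r a x b y * Γ.lad S x y c d) = -Γ.ext (stack T S x y) e e' r a b c d := by
  -- Renaming `x` and `y` identifies two of the three pairings. Since `S` is symmetric, no
  -- correction by (IHX) is needed here, unlike in `ext_across`.
  have h1 := hT.ext_sum e e' r a x b y
  have h2 := Γ.relabel_atoms (κ := Bool) (fun i => bif i then T else S)
    ![a, b, c, d, e, e', r, x, y] (Equiv.swap 7 8)
    [.leg true 4 5 1 8, .tri 4 6 0, .tri 5 6 7, .leg false 7 8 2 3] (by decide)
  simp [weight, Equiv.swap_apply_def] at h2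
  have h3 := hT.ext_comm_right e e' r a y x b
  have h4 := hS.swap₁ y x c d
  rw [h4] at h2
  simp only [ext, lad_stack] at h1 h3 ⊢
  linear_combination Γ.lad S x y c d * h1 - Γ.lad S x y c d * h3 + h2

namespace Symmetric

theorem ext₂_relabel (V : L × List (L × L × L)) (e e' r x y s a b c d : L) :
    Γ.ext₂ V e e' r x y s a b c d = Γ.ext₂ V e y s x e' r a b c d := by
  have h2 := Γ.relabel_atoms (κ := Unit) (fun _ => V)
    ![a, b, c, d, e, e', r, x, y, s] (Equiv.swap 5 8 * Equiv.swap 6 9)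
    [.leg () 4 5 2 3, .tri 4 6 7, .tri 5 6 8, .tri 7 9 0, .tri 8 9 1] (by decide)
  simp [weight, Equiv.swap_apply_def] at h2
  simp only [ext₂, ext]
  linear_combination h2

/-- The vertex `f z x y` is joined to three legs of an even ladder. By (IHX) on `x` the piece is a
difference of two ladders with two rungs, one of them glued across. By `ext_across` both are `-1/2`
times the same symmetric `ext₂`. -/
theorem tripod_eq_zero {V : L × List (L × L × L)} (hV : Γ.Symmetric V)
    (e₁ e₂ e₃ x y z a b c d : L) :
    Γ.lad V e₁ e₂ e₃ d * (Γ.f e₁ x a * Γ.f e₂ z b * Γ.f e₃ y c * Γ.f z x y) = 0 := by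
  have h1 := Γ.ihx x y z a e₁
  have h2 := hV.ext_across e₁ e₃ y x e₂ z a b c d
  have h3 := hV.ext_across e₁ e₂ z x e₃ y a c b d
  have h4 := ext₂_relabel (Γ := Γ) V e₁ e₃ y x e₂ z a b c d
  have h5 := hV.ext₂_comm_middle e₁ e₂ z x e₃ y a b c d
  rw [ext, ← hV.swap₂ e₁ e₂ e₃ d] at h2
  rw [ext] at h3
  rw [Γ.f_right x y z, Γ.f_right x a e₁, Γ.f_rev x y e₁, Γ.f_rev x z e₁, Γ.f_left x a y] at h1
  refine two_cancel ?_
  linear_combination 2 * Γ.lad V e₁ e₂ e₃ d * Γ.f e₂ z b * Γ.f e₃ y c * h1 + h2 - h3 - h4 - h5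

/-- Slide the foot of `z` from the strand between `T` and `S` over the ends of `T`. At `e₁` it
closes a triangle, at `b` it produces the tripod on the stack of `T` and `S`, and at the other
connecting strand `m` it gives the original term again. So twice the term vanishes. -/
theorem theta_eq_zero {T S : L × List (L × L × L)} (hT : Γ.Symmetric T) (hS : Γ.Symmetric S)
    (hV : ∀ m m', Γ.Symmetric (stack T S m m')) (a b c d e₁ e₂ e₃ e₄ m x y z : L) :
    Γ.lad T e₁ e₂ b m * Γ.lad S e₃ e₄ m d *
      (Γ.f e₁ x a * Γ.f e₄ y c * Γ.f z e₃ e₂ * Γ.f z x y) = 0 := by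
  have h1 := Γ.kirchhoff T e₂ z e₃ e₁ b m
  have h2 := Γ.triangle e₂ a y z e₁ x
  have h3 := (hV e₃ m).tripod_eq_zero e₁ e₂ e₄ x y z a b c d
  have h4 := Γ.relabel_atoms (κ := Bool) (fun i => bif i then T else S)
    ![a, b, c, d, e₁, e₂, e₃, e₄, m, x, y, z] (Equiv.swap 6 8)
    [.leg true 4 5 1 8, .leg false 6 7 8 3, .tri 4 9 0, .tri 7 10 2, .tri 11 6 5, .tri 11 9 10]
    (by decide)
  simp [weight, Equiv.swap_apply_def] at h4
  rw [lad_stack] at h3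
  rw [Γ.rot e₂ z e₃, hT.swap₁ e₂ e₁, hT.swap₁ e₃ e₁, hT.swap₂ e₁ e₃, Γ.rot e₂ z m,
    hT.swap₁ e₃ e₁, hT.swap₂ e₁ e₃, hT.swap₃ e₁ b, hT.swap₂ e₁ b] at h1
  rw [hS.swap₁ m, hS.swap₂ e₄ m, hS.swap₁ e₄ e₃] at h4
  rw [hS.swap₂ e₃ m] at h3
  rw [← Γ.f_right e₁ x a, Γ.f_left y x z, ← Γ.f_right z x y] at h2
  refine two_cancel ?_
  linear_combination Γ.lad S e₃ e₄ m d * Γ.f e₁ x a * Γ.f e₄ y c * Γ.f z x y * h1 +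
    Γ.lad T e₃ e₂ b m * Γ.lad S e₃ e₄ m d * Γ.f e₄ y c * h2 - h3 + h4

/-- By `ext_stack` the piece is a multiple of an odd ladder in which the non-neighbouring ends `a`
and `c` meet at a vertex, as in (x). -/
theorem ext_stack_loop {T S : L × List (L × L × L)} (hT : Γ.Symmetric T) (hS : Γ.Symmetric S)
    {x y : L} (hV : Γ.Symmetric (stack T S x y)) (e e' r a b c d z : L) :
    Γ.ext T e e' r a x b y * Γ.lad S x y c d * Γ.f a c z = 0 := by
  have h1 := ext_stack hT hS e e' r x y a b c d
  have h2 := hV.ext_loop e e' r a c z b d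
  refine two_cancel ?_
  linear_combination Γ.f a c z * h1 - h2

/-- (IHX) on the connecting strand `m` crosses the rungs `x` and `y`, up to a term killed by
`theta_eq_zero`. Then slide the leg `a` over the ends of `T`: the term at `e₂` vanishes by
`theta_eq_zero`, the term at `b` by `ext_stack_loop`, and the term at `n` is the right-hand side. -/
theorem parallel_aux {T S : L × List (L × L × L)} (hT : Γ.Symmetric T) (hS : Γ.Symmetric S)
    (hV : ∀ m m', Γ.Symmetric (stack T S m m')) (a b c d e₁ e₂ e₃ e₄ m n x y : L) :
    Γ.ext T e₁ e₂ x a m b n * Γ.ext S e₃ e₄ y m c n d =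
      -(Γ.ext T e₂ x m y e₃ b e₁ * (Γ.f e₁ a n * Γ.lad S e₃ e₄ n d * Γ.f e₄ y c)) := by
  have h1 := Γ.ihx m e₂ x e₃ y
  have h2 := theta_eq_zero hT hS hV a b c d e₁ e₂ e₃ e₄ n x y m
  have h3 := Γ.kirchhoff T e₁ a x e₂ b n
  have h4 := theta_eq_zero hT hS hV a b c d e₁ x e₃ e₄ n e₂ y m
  have h5 := ext_stack_loop hT hS (hV e₃ n) e₂ x m y e₁ e₄ d c
  rw [Γ.f_left e₁ a x, Γ.f_left e₁ a e₂, hT.swap₁ x e₁, hT.swap₁ x e₂, hT.swap₁ x e₂] at h3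
  rw [hS.swap₂ e₃ n, Γ.anti y e₄, ext, Γ.anti e₂ m y, Γ.anti x m e₃] at h5
  simp only [ext]
  rw [Γ.f_right e₂ x m, Γ.f_right e₃ y m, Γ.anti e₂ m y, Γ.anti x m e₃]
  rw [Γ.f_left m x e₃] at h1 h5 ⊢
  linear_combination Γ.lad T e₁ e₂ b n * Γ.lad S e₃ e₄ n d * Γ.f e₁ x a * Γ.f e₄ y c * h1 - h2 -
    Γ.lad S e₃ e₄ n d * Γ.f e₄ y c * Γ.f m e₃ x * Γ.f m e₂ y * h3 - h4 + Γ.f e₁ a b * h5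

/-- Two ladders with an odd number of rungs, placed in parallel. -/
theorem parallel {T S : L × List (L × L × L)} (hT : Γ.Symmetric T) (hS : Γ.Symmetric S)
    (hV : ∀ m m', Γ.Symmetric (stack T S m m')) (a b c d e₁ e₂ e₃ e₄ m n x y : L) :
    4 * (Γ.lad (T.1, (e₁, e₂, x) :: T.2) a m b n * Γ.lad (S.1, (e₃, e₄, y) :: S.2) m c n d) =
      Γ.lad ((stack T S y e₃).1, (e₁, e₄, n) :: (e₂, x, m) :: (stack T S y e₃).2) a b c d := by
  -- By `h1` the piece from `parallel_aux` becomes a sum over two pairings. After `h9` these are the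
  -- terms at `e₃` and `y` of `h2`, which slides the leg `c` over the ends of `S`. The term at `d`
  -- vanishes by `h4`. In the term at `n`, `h5` and `h6` each contribute a factor `-1/2`, hence the
  -- 4.
  have h0 := parallel_aux hT hS hV a b c d e₁ e₂ e₃ e₄ m n x y
  have h1 := hT.ext_sum e₂ x m y e₃ b e₁
  have h2 := Γ.kirchhoff S e₄ c e₃ y n d
  have h3 := Γ.relabel_atoms (κ := Bool) (fun i => bif i then T else S)
    ![a, b, c, d, e₁, e₂, e₃, e₄, n, x, y, m] (Equiv.swap 6 10)
    [.leg true 5 9 10 1, .tri 5 11 6, .tri 9 11 4, .tri 7 2 10, .leg false 7 6 8 3, .tri 4 0 8]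
    (by decide)
  simp [weight, Equiv.swap_apply_def] at h3
  have h4 := ext_stack_loop hT hS (hV y e₃) e₂ x m e₁ b n e₄ a
  have h5 := ext_stack hT hS e₂ x m y e₃ e₁ b e₄ d
  have h6 := (hV y e₃).ext_across e₂ x m e₁ e₄ n a c b d
  rw [hT.lad_cons, hS.lad_cons, (hV y e₃).lad_cons_cons, (hV y e₃).ext₂_comm_left,
    (hV y e₃).ext₂_comm_middle, (hV y e₃).ext₂_comm_left, (hV y e₃).ext₂_comm_right,
    (hV y e₃).ext₂_comm_middle, (hV y e₃).ext₂_comm_right]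
  rw [← (hV y e₃).ext₂_comm_middle] at h6
  have h7 : Γ.ext T e₂ x m y b e₃ e₁ = Γ.ext T e₂ x m e₃ e₁ y b := by
    rw [hT.ext_flip]
  have h8 : Γ.ext T e₂ x m y e₁ e₃ b = Γ.ext T e₂ x m e₁ y b e₃ := by
    rw [hT.ext_comm_left, hT.ext_comm_right]
  rw [h7, h8] at h1
  rw [hS.swap₁ e₄ y, hS.swap₁ e₃ y, hS.swap₁ e₃ y] at h2
  rw [hS.swap₁ e₄ e₃, hS.swap₁ e₄ y] at h3
  rw [Γ.f_left e₁ n a] at h4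
  rw [Γ.f_left e₄ y c] at h0
  rw [Γ.f_left e₄ n c, Γ.f_left e₁ n a] at h6
  have h9 : Γ.ext T e₂ x m e₃ e₁ y b * (Γ.f e₄ c y * Γ.lad S e₃ e₄ n d * Γ.f e₁ a n) =
      Γ.ext T e₂ x m e₁ y b e₃ * (Γ.f e₄ c e₃ * Γ.lad S y e₄ n d * Γ.f e₁ a n) := by
    rw [← h8, ext, ext]
    linear_combination h3
  linear_combination 4 * h0 + 4 * (Γ.f e₁ a n * Γ.lad S e₃ e₄ n d * Γ.f e₄ c y) * h1 - 4 * h9 -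
    4 * (Γ.ext T e₂ x m e₁ y b e₃ * Γ.f e₁ a n) * h2 - 4 * Γ.f e₄ c d * h4 +
    2 * Γ.f e₁ a n * Γ.f e₄ c n * h5 - h6

end Symmetric

end NetAlgebra

/-! ### Diagrams presented by labelled nets. -/

/-- The part of a diagram that is kept fixed: trivalent vertices and univalent vertices, with a
label for every half-edge. -/
structure NetContext {k : ℕ} (u : Fin k → ℕ) (M : Type) : Type 1 where
  K : Type
  U : Type
  finite_K : Finite K
  finite_U : Finite U
  vertex : Equiv.Perm K
  vertex_cube : ∀ h, vertex (vertex (vertex h)) = h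
  vertex_ne : ∀ h, vertex h ≠ h
  color : U → Fin k
  card_color : ∀ i, Nat.card {v : U // color v = i} = u i
  label : K ⊕ U → M

section Diagrams

variable {k : ℕ} {u : Fin k → ℕ} {M : Type}

/-- A labelling of the half-edges of a diagram whose fibres are the edges, such that the diagram
consists of the context and of trivalent vertices with the labels `t`. -/
structure DiagramLabelling (Γ : NetContext u M) {J : Type} (t : J → Fin 3 → M) (D : Diagram u) where
  onH : (J × Fin 3) ⊕ Γ.K ≃ D.H
  onU : Γ.U ≃ D.U
  label : D.H ⊕ D.U → M
  map_vertex_inl : ∀ j i, D.vertex (onH (Sum.inl (j, i))) = onH (Sum.inl (j, i + 1))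
  map_vertex_inr : ∀ x, D.vertex (onH (Sum.inr x)) = onH (Sum.inr (Γ.vertex x))
  map_color : ∀ v, D.color (onU v) = Γ.color v
  label_net : ∀ j i, label (Sum.inl (onH (Sum.inl (j, i)))) = t j i
  label_K : ∀ x, label (Sum.inl (onH (Sum.inr x))) = Γ.label (Sum.inl x)
  label_U : ∀ v, label (Sum.inr (onU v)) = Γ.label (Sum.inr v)
  label_eq : ∀ x y, label x = label y ↔ y = x ∨ y = D.edge x

/-- The analogue of `DiagramLabelling` for the rest of a diagram, with labels `w` at the ends. -/
structure RestLabelling (Γ : NetContext u M) {B J : Type} (t : J → Fin 3 → M) (w : B → M)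
    (C : Rest B u) where
  onK : (J × Fin 3) ⊕ Γ.K ≃ C.K
  onU : Γ.U ≃ C.U
  label : B ⊕ (C.K ⊕ C.U) → M
  map_vertex_inl : ∀ j i, C.vertex (onK (Sum.inl (j, i))) = onK (Sum.inl (j, i + 1))
  map_vertex_inr : ∀ x, C.vertex (onK (Sum.inr x)) = onK (Sum.inr (Γ.vertex x))
  map_color : ∀ v, C.color (onU v) = Γ.color v
  label_end : ∀ b, label (Sum.inl b) = w b
  label_net : ∀ j i, label (Sum.inr (Sum.inl (onK (Sum.inl (j, i))))) = t j i
  label_K : ∀ x, label (Sum.inr (Sum.inl (onK (Sum.inr x)))) = Γ.label (Sum.inl x)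
  label_U : ∀ v, label (Sum.inr (Sum.inr (onU v))) = Γ.label (Sum.inr v)
  label_eq : ∀ x y, label x = label y ↔ y = x ∨ y = C.edge x

/-- A labelling of the half-edges of a piece, constant on edges, such that the vertices have the
labels `t` and the ends have the labels `w`. -/
structure PieceLabelling {B J : Type} (t : J → Fin 3 → M) (w : B → M) (P : Piece B) where
  onH : J × Fin 3 ≃ P.I ⊕ B
  label : P.I ⊕ B → M
  map_vertex : ∀ j i, P.vertex (onH (j, i)) = onH (j, i + 1)
  label_net : ∀ j i, label (onH (j, i)) = t j i
  label_end : ∀ b, label (Sum.inr b) = w b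
  label_edge : ∀ x, label (Sum.inl (P.edge x)) = label (Sum.inl x)

/-- Different edges inside of the piece have different labels. -/
def PieceLabelling.Faithful {B J : Type} {t : J → Fin 3 → M} {w : B → M} {P : Piece B}
    (L : PieceLabelling t w P) : Prop :=
  ∀ x y, L.label (Sum.inl x) = L.label (Sum.inl y) → y = x ∨ y = P.edge x

namespace DiagramLabelling

variable {Γ : NetContext u M} {J J' : Type} {t : J → Fin 3 → M} {D D' : Diagram u}

/-- Two diagrams with the same labels are isomorphic. -/
noncomputable def iso (S : DiagramLabelling Γ t D) (S' : DiagramLabelling Γ t D') : D.Iso D' where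
  onH := S.onH.symm.trans S'.onH
  onU := S.onU.symm.trans S'.onU
  map_vertex h := by
    obtain ⟨x, rfl⟩ := S.onH.surjective h
    rcases x with ⟨j, i⟩ | x
    · simp [S.map_vertex_inl, S'.map_vertex_inl]
    · simp [S.map_vertex_inr, S'.map_vertex_inr]
  map_edge x := by
    have key : ∀ y, S'.label (Sum.map (S.onH.symm.trans S'.onH) (S.onU.symm.trans S'.onU) y) =
        S.label y := by
      rintro (y | y)
      · obtain ⟨y, rfl⟩ := S.onH.surjective y
        rcases y with ⟨j, i⟩ | y
        · simp [S.label_net, S'.label_net]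
        · simp [S.label_K, S'.label_K]
      · obtain ⟨y, rfl⟩ := S.onU.surjective y
        simp [S.label_U, S'.label_U]
    have h := (S.label_eq x (D.edge x)).2 (Or.inr rfl)
    rw [← key, ← key, S'.label_eq] at h
    refine h.resolve_left fun h => D.edge_ne x ?_
    refine Sum.map_injective.2 ⟨?_, ?_⟩ h
    · exact (S.onH.symm.trans S'.onH).injective
    · exact (S.onU.symm.trans S'.onU).injective
  map_color v := by
    obtain ⟨v, rfl⟩ := S.onU.surjective v
    simp [S.map_color, S'.map_color]

/-- The same labelling with renamed vertices. -/
def reindex (S : DiagramLabelling Γ t D) (e : J' ≃ J) : DiagramLabelling Γ (t ∘ e) D where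
  onH := (Equiv.sumCongr (Equiv.prodCongr e (Equiv.refl _)) (Equiv.refl _)).trans S.onH
  onU := S.onU
  label := S.label
  map_vertex_inl j i := by simp [S.map_vertex_inl]
  map_vertex_inr x := by simp [S.map_vertex_inr]
  map_color := S.map_color
  label_net j i := by simp [S.label_net]
  label_K x := by simp [S.label_K]
  label_U := S.label_U
  label_eq := S.label_eq

end DiagramLabelling

/-- Equal multisets have fibres of equal size over every point; matching these fibres reindexes one
family as the other. -/
theorem exists_equiv_of_map_eq {J J' X : Type} [Fintype J] [Fintype J'] {t : J → X} {t' : J' → X}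
    (h : Finset.univ.val.map t = Finset.univ.val.map t') : ∃ e : J ≃ J', t = t' ∘ e := by
  classical
  have hc : ∀ x, Nonempty ({j // t j = x} ≃ {j // t' j = x}) := by
    intro x
    rw [← Fintype.card_eq, Fintype.card_subtype, Fintype.card_subtype]
    have := congrArg (Multiset.count x) h
    rw [Multiset.count_map, Multiset.count_map] at this
    simpa [Finset.card, eq_comm] using this
  have e := fun x => (hc x).some
  refine ⟨(Equiv.sigmaFiberEquiv t).symm.trans
    ((Equiv.sigmaCongrRight e).trans (Equiv.sigmaFiberEquiv t')), ?_⟩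
  funext j
  exact ((e (t j) ⟨j, rfl⟩).2).symm

/-- The class of a diagram. -/
noncomputable def Diagram.toBHat (D : Diagram u) : BHat u :=
  Submodule.Quotient.mk (Finsupp.single D 1)

theorem Diagram.Iso.toBHat_eq {D D' : Diagram u} (f : D.Iso D') : D.toBHat = D'.toBHat :=
  (Submodule.Quotient.eq _).2 (Submodule.subset_span (IsRelation.iso D D' f))

namespace NetContext

/-- The diagram `D` consists of the context and trivalent vertices with the labels `s`. -/
def Presents (Γ : NetContext u M) (s : Multiset (Fin 3 → M)) (D : Diagram u) : Prop :=
  ∃ (J : Type) (_ : Fintype J) (t : J → Fin 3 → M),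
    Finset.univ.val.map t = s ∧ Nonempty (DiagramLabelling Γ t D)

variable {Γ : NetContext u M} {s s' : Multiset (Fin 3 → M)} {D D' : Diagram u}

theorem Presents.toBHat_eq (h : Γ.Presents s D) (h' : Γ.Presents s D') :
    D.toBHat = D'.toBHat := by
  obtain ⟨J, _, t, ht, ⟨S⟩⟩ := h
  obtain ⟨J', _, t', ht', ⟨S'⟩⟩ := h'
  obtain ⟨e, rfl⟩ := exists_equiv_of_map_eq (ht.trans ht'.symm)
  exact (S.iso (S'.reindex e)).toBHat_eq

variable (Γ) in
open Classical in
/-- The class of the diagram that consists of the context and trivalent vertices with the labels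
`s`, or zero if there is no such diagram. -/
noncomputable def value (s : Multiset (Fin 3 → M)) : BHat u :=
  if h : ∃ D, Γ.Presents s D then h.choose.toBHat else 0

theorem Presents.value_eq (h : Γ.Presents s D) : Γ.value s = D.toBHat := by
  have h' : ∃ D, Γ.Presents s D := ⟨D, h⟩
  rw [value, dif_pos h']
  exact h'.choose_spec.toBHat_eq h

theorem value_eq_zero (h : ¬∃ D, Γ.Presents s D) : Γ.value s = 0 := dif_neg h

theorem value_congr (h : ∀ D, Γ.Presents s D ↔ Γ.Presents s' D) : Γ.value s = Γ.value s' := by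
  by_cases hs : ∃ D, Γ.Presents s D
  · obtain ⟨D, hD⟩ := hs
    rw [hD.value_eq, ((h D).1 hD).value_eq]
  · rw [value_eq_zero hs, value_eq_zero]
    simpa [h] using hs

end NetContext

/-! ### Gluing a piece into a rest and cutting it out again. -/

section Fill

variable {Γ : NetContext u M} {B J₀ J₁ : Type} [Finite B] {t₀ : J₀ → Fin 3 → M}
  {t₁ : J₁ → Fin 3 → M} {w : B → M} {C : Rest B u} {P : Piece B}

/-- The labelling of a diagram that is glued from two labelled parts. -/
def RestLabelling.fill (S : RestLabelling Γ t₁ w C) (L : PieceLabelling t₀ w P) (hL : L.Faithful)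
    (h : ∀ x y, L.label (Sum.inl x) ≠ S.label y) :
    DiagramLabelling Γ (Sum.elim t₀ t₁) (C.fill P) where
  onH := (Equiv.sumCongr (Equiv.sumProdDistrib J₀ J₁ (Fin 3)) (Equiv.refl Γ.K)).trans
    ((Equiv.sumAssoc _ _ _).trans (Equiv.sumCongr L.onH S.onK))
  onU := S.onU
  label := Sum.elim (L.label ∘ Sum.inl) S.label ∘ regroup P.I B C.K C.U
  map_vertex_inl j i := by
    rcases j with j | j
    · exact congrArg Sum.inl (L.map_vertex j i)
    · exact congrArg Sum.inr (S.map_vertex_inl j i)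
  map_vertex_inr x := congrArg Sum.inr (S.map_vertex_inr x)
  map_color := S.map_color
  label_net j i := by
    rcases j with j | j
    · have h : ∀ z, Sum.elim (L.label ∘ Sum.inl) S.label
          (regroup P.I B C.K C.U (Sum.inl (Sum.inl z))) = L.label z := by
        rintro (z | z)
        · rfl
        · exact (S.label_end z).trans (L.label_end z).symm
      exact (h _).trans (L.label_net j i)
    · exact S.label_net j i
  label_K := S.label_K
  label_U := S.label_U
  label_eq x y := by
    obtain ⟨x, rfl⟩ := (regroup P.I B C.K C.U).symm.surjective x
    obtain ⟨y, rfl⟩ := (regroup P.I B C.K C.U).symm.surjective y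
    change Sum.elim (L.label ∘ Sum.inl) S.label (regroup P.I B C.K C.U _) =
      Sum.elim (L.label ∘ Sum.inl) S.label (regroup P.I B C.K C.U _) ↔
        @Eq (((P.I ⊕ B) ⊕ C.K) ⊕ C.U) _ _ ∨ _ = (regroup P.I B C.K C.U).symm
          (Equiv.sumCongr P.edge C.edge (regroup P.I B C.K C.U _))
    simp only [Equiv.apply_symm_apply, EmbeddingLike.apply_eq_iff_eq]
    rcases x with x | x <;> rcases y with y | y
    · simp only [Sum.elim_inl, Function.comp_apply, Sum.inl.injEq, Equiv.sumCongr_apply,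
        Sum.map_inl]
      refine ⟨hL x y, ?_⟩
      rintro (rfl | rfl)
      · rfl
      · exact (L.label_edge x).symm
    · simpa using h x y
    · simpa using (h y x).symm
    · simpa using S.label_eq x y

end Fill

namespace DiagramLabelling

variable {Γ : NetContext u M} {B J₀ J₁ : Type} {t₀ : J₀ → Fin 3 → M}
  {t₁ : J₁ → Fin 3 → M} {w : B → M} {D : Diagram u} {P : Piece B}

/-- The half-edges of a diagram, listed as those of a piece and those outside of the piece. -/
def split (S : DiagramLabelling Γ (Sum.elim t₀ t₁) D) (L : PieceLabelling t₀ w P) :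
    P.I ⊕ (B ⊕ (((J₁ × Fin 3) ⊕ Γ.K) ⊕ Γ.U)) ≃ D.H ⊕ D.U :=
  (regroup _ _ _ _).symm.trans (Equiv.sumCongr
    ((Equiv.sumCongr L.onH.symm (Equiv.refl _)).trans ((Equiv.sumAssoc _ _ _).symm.trans
      ((Equiv.sumCongr (Equiv.sumProdDistrib J₀ J₁ (Fin 3)).symm (Equiv.refl _)).trans S.onH)))
    S.onU)

variable (S : DiagramLabelling Γ (Sum.elim t₀ t₁) D) (L : PieceLabelling t₀ w P)

theorem split_inl (x : P.I) :
    S.split L (Sum.inl x) = Sum.inl (S.onH (Sum.inl (Sum.inl (L.onH.symm (Sum.inl x)).1,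
      (L.onH.symm (Sum.inl x)).2))) := rfl

theorem split_end (b : B) :
    S.split L (Sum.inr (Sum.inl b)) = Sum.inl (S.onH (Sum.inl (Sum.inl (L.onH.symm (Sum.inr b)).1,
      (L.onH.symm (Sum.inr b)).2))) := rfl

theorem split_net (j : J₁) (i : Fin 3) :
    S.split L (Sum.inr (Sum.inr (Sum.inl (Sum.inl (j, i))))) =
      Sum.inl (S.onH (Sum.inl (Sum.inr j, i))) := rfl

theorem split_K (x : Γ.K) :
    S.split L (Sum.inr (Sum.inr (Sum.inl (Sum.inr x)))) = Sum.inl (S.onH (Sum.inr x)) := rfl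

theorem split_U (v : Γ.U) :
    S.split L (Sum.inr (Sum.inr (Sum.inr v))) = Sum.inr (S.onU v) := rfl

theorem split_onH (j : J₀) (i : Fin 3) :
    S.split L (Sum.map id Sum.inl (L.onH (j, i))) = Sum.inl (S.onH (Sum.inl (Sum.inl j, i))) := by
  have h := L.onH.symm_apply_apply (j, i)
  rcases hx : L.onH (j, i) with x | x
  · rw [hx] at h
    rw [Sum.map_inl, id, split_inl, h]
  · rw [hx] at h
    rw [Sum.map_inr, split_end, h]

theorem label_split (z : P.I ⊕ B) : S.label (S.split L (Sum.map id Sum.inl z)) = L.label z := by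
  obtain ⟨⟨j, i⟩, rfl⟩ := L.onH.surjective z
  rw [split_onH, S.label_net, L.label_net, Sum.elim_inl]

theorem label_split_inl (x : P.I) : S.label (S.split L (Sum.inl x)) = L.label (Sum.inl x) :=
  S.label_split L (Sum.inl x)

theorem edge_split_inl (x : P.I) :
    D.edge (S.split L (Sum.inl x)) = S.split L (Sum.inl (P.edge x)) := by
  have h := (S.label_split_inl L x).trans ((L.label_edge x).symm.trans
    (S.label_split_inl L (P.edge x)).symm)
  rw [S.label_eq] at h
  refine (h.resolve_left fun h => P.edge_ne x ?_).symm
  exact Sum.inl_injective ((S.split L).injective h)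

/-- The edges of a diagram outside of a piece. -/
def outerEdge (y : B ⊕ (((J₁ × Fin 3) ⊕ Γ.K) ⊕ Γ.U)) : B ⊕ (((J₁ × Fin 3) ⊕ Γ.K) ⊕ Γ.U) :=
  -- The default `y` is never taken: inner edges stay inside the piece, so an outer half-edge has an
  -- outer partner.
  ((S.split L).symm (D.edge (S.split L (Sum.inr y)))).elim (fun _ => y) id

theorem edge_split_inr (y : B ⊕ (((J₁ × Fin 3) ⊕ Γ.K) ⊕ Γ.U)) :
    D.edge (S.split L (Sum.inr y)) = S.split L (Sum.inr (S.outerEdge L y)) := by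
  rw [← Equiv.symm_apply_eq, outerEdge]
  rcases h : (S.split L).symm (D.edge (S.split L (Sum.inr y))) with x | x
  · rw [Equiv.symm_apply_eq] at h
    have h' := congrArg D.edge h
    rw [D.edge_edge, edge_split_inl] at h'
    exact absurd ((S.split L).injective h') Sum.inr_ne_inl
  · rfl

theorem outerEdge_outerEdge (y : B ⊕ (((J₁ × Fin 3) ⊕ Γ.K) ⊕ Γ.U)) :
    S.outerEdge L (S.outerEdge L y) = y := by
  have h := D.edge_edge (S.split L (Sum.inr y))
  rw [edge_split_inr, edge_split_inr] at h
  exact Sum.inr_injective ((S.split L).injective h)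

theorem vertex_split (z : P.I ⊕ B) :
    Sum.map D.vertex id (S.split L (Sum.map id Sum.inl z)) =
      S.split L (Sum.map id Sum.inl (P.vertex z)) := by
  obtain ⟨⟨j, i⟩, rfl⟩ := L.onH.surjective z
  rw [split_onH, L.map_vertex, split_onH, Sum.map_inl, S.map_vertex_inl]

/-- The cyclic permutation of the half-edges at the vertices outside of a piece. -/
def outerVertex (J : Type) (Γ : NetContext u M) : Equiv.Perm ((J × Fin 3) ⊕ Γ.K) :=
  Equiv.sumCongr (Equiv.prodCongr (Equiv.refl J) (Equiv.addRight 1)) Γ.vertex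

/-- The diagram is connected, so every outer half-edge is joined to the piece by a chain, and a
chain can leave the piece only through an end. The property `Q`, void inside the piece and true at
its ends, is carried along such a chain. -/
theorem outer_reach (y : B ⊕ (((J₁ × Fin 3) ⊕ Γ.K) ⊕ Γ.U)) :
    ∃ b, Linked (S.outerEdge L) (Sum.map id (Sum.map (outerVertex J₁ Γ) id)) (Sum.inl b) y := by
  let Q : D.H ⊕ D.U → Prop := fun z => ∀ y, z = S.split L (Sum.inr y) →
    ∃ b, Linked (S.outerEdge L) (Sum.map id (Sum.map (outerVertex J₁ Γ) id)) (Sum.inl b) y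
  have hQ : ∀ z z', Linked D.edge (Sum.map D.vertex id) z z' → (Q z ↔ Q z') := by
    intro z z' h
    induction h with
    | refl => rfl
    | symm _ _ _ ih => exact ih.symm
    | trans _ _ _ _ _ ih₁ ih₂ => exact ih₁.trans ih₂
    | rel z z' h =>
      obtain ⟨z, rfl⟩ := (S.split L).surjective z
      have step : ∀ y y', Linked (S.outerEdge L) (Sum.map id (Sum.map (outerVertex J₁ Γ) id)) y y' →
          (Q (S.split L (Sum.inr y)) ↔ Q (S.split L (Sum.inr y'))) := by
        intro y y' h
        have hy : ∀ y, Q (S.split L (Sum.inr y)) ↔ ∃ b, Linked (S.outerEdge L)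
            (Sum.map id (Sum.map (outerVertex J₁ Γ) id)) (Sum.inl b) y := by
          refine fun y => ⟨fun h => h y rfl, fun h y' hy' => ?_⟩
          rwa [← Sum.inr_injective ((S.split L).injective hy')]
        rw [hy, hy]
        exact ⟨fun ⟨b, hb⟩ => ⟨b, hb.trans _ _ _ h⟩,
          fun ⟨b, hb⟩ => ⟨b, hb.trans _ _ _ (h.symm _ _)⟩⟩
      have inner : ∀ z : P.I ⊕ B, Q (S.split L (Sum.map id Sum.inl z)) := by
        rintro (x | b) y hy
        · exact absurd ((S.split L).injective hy) Sum.inl_ne_inr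
        · refine ⟨b, ?_⟩
          rw [← Sum.inr_injective ((S.split L).injective hy)]
          exact Relation.EqvGen.refl _
      rcases h with rfl | rfl
      · rcases z with x | y
        · rw [edge_split_inl]
          exact iff_of_true (inner (Sum.inl x)) (inner (Sum.inl _))
        · rw [edge_split_inr]
          exact step _ _ (Linked.left _ rfl)
      · have hz : ∀ z : P.I ⊕ B, Q (S.split L (Sum.map id Sum.inl z)) ↔
            Q (Sum.map D.vertex id (S.split L (Sum.map id Sum.inl z))) := fun z => by
          rw [vertex_split]
          exact iff_of_true (inner _) (inner _)
        rcases z with x | b | (⟨j, i⟩ | x) | v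
        · exact hz (Sum.inl x)
        · exact hz (Sum.inr b)
        · rw [split_net, Sum.map_inl, S.map_vertex_inl, ← S.split_net L, ← S.split_net L]
          exact step _ _ (Linked.right _ rfl)
        · rw [split_K, Sum.map_inl, S.map_vertex_inr, ← S.split_K L, ← S.split_K L]
          exact step _ _ (Linked.right _ rfl)
        · rw [split_U]
          rfl
  obtain ⟨z⟩ := P.nonempty
  have h0 : Q (S.split L (Sum.map id Sum.inl z)) := by
    rcases z with x | b
    · exact fun y hy => absurd ((S.split L).injective hy) Sum.inl_ne_inr
    · intro y hy
      refine ⟨b, ?_⟩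
      rw [← Sum.inr_injective ((S.split L).injective hy)]
      exact Relation.EqvGen.refl _
  exact (hQ _ _ (D.connected _ _)).1 h0 y rfl

/-- The rest of a diagram outside of a piece. -/
def rest [Finite J₁] : Rest B u where
  K := (J₁ × Fin 3) ⊕ Γ.K
  U := Γ.U
  finite_K := by
    have := Γ.finite_K
    infer_instance
  finite_U := Γ.finite_U
  vertex := outerVertex J₁ Γ
  vertex_cube := by
    rintro (⟨j, i⟩ | x)
    · simp only [outerVertex, Equiv.sumCongr_apply, Sum.map_inl, Equiv.prodCongr_apply,
        Prod.map_apply, Equiv.refl_apply, Equiv.coe_addRight]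
      rw [add_assoc, add_assoc, show (1 + (1 + 1) : Fin 3) = 0 from rfl, add_zero]
    · simp [outerVertex, Γ.vertex_cube]
  vertex_ne := by
    rintro (⟨j, i⟩ | x)
    · simp [outerVertex]
    · simpa [outerVertex] using Γ.vertex_ne x
  edge := Function.Involutive.toPerm (S.outerEdge L) (S.outerEdge_outerEdge L)
  edge_edge := S.outerEdge_outerEdge L
  edge_ne y h := by
    have h' := S.edge_split_inr L y
    rw [show S.outerEdge L y = y from h] at h'
    exact D.edge_ne _ h'
  color := Γ.color
  card_color := Γ.card_color
  reach := S.outer_reach L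

theorem outer_label_eq (x y : B ⊕ (((J₁ × Fin 3) ⊕ Γ.K) ⊕ Γ.U)) :
    S.label (S.split L (Sum.inr x)) = S.label (S.split L (Sum.inr y)) ↔
      y = x ∨ y = S.outerEdge L x := by
  rw [S.label_eq, edge_split_inr, EmbeddingLike.apply_eq_iff_eq, EmbeddingLike.apply_eq_iff_eq,
    Sum.inr.injEq, Sum.inr.injEq]

/-- The labelling of the rest of a diagram. -/
def restLabelling [Finite J₁] : RestLabelling Γ t₁ w (S.rest L) where
  onK := Equiv.refl _
  onU := Equiv.refl _
  label y := S.label (S.split L (Sum.inr y))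
  map_vertex_inl _ _ := rfl
  map_vertex_inr _ := rfl
  map_color _ := rfl
  label_end b := (S.label_split L (Sum.inr b)).trans (L.label_end b)
  label_net j i := S.label_net (Sum.inr j) i
  label_K := S.label_K
  label_U := S.label_U
  label_eq := S.outer_label_eq L

/-- Labels separate the edges of a diagram, so a piece found inside one automatically has distinct
inner labels. Hence cutting out needs no assumption of distinctness; only filling in does. -/
theorem faithful (S : DiagramLabelling Γ (Sum.elim t₀ t₁) D) (L : PieceLabelling t₀ w P) :
    L.Faithful := by
  intro x y h
  rw [← S.label_split_inl, ← S.label_split_inl, S.label_eq, edge_split_inl,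
    EmbeddingLike.apply_eq_iff_eq, EmbeddingLike.apply_eq_iff_eq, Sum.inl.injEq,
    Sum.inl.injEq] at h
  exact h

theorem label_ne [Finite J₁] (x : P.I) (y : B ⊕ (((J₁ × Fin 3) ⊕ Γ.K) ⊕ Γ.U)) :
    L.label (Sum.inl x) ≠ (S.restLabelling L).label y := by
  rw [← S.label_split_inl L]
  intro h
  rw [show (S.restLabelling L).label y = S.label (S.split L (Sum.inr y)) from rfl, S.label_eq,
    edge_split_inl, EmbeddingLike.apply_eq_iff_eq, EmbeddingLike.apply_eq_iff_eq] at h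
  simp at h

end DiagramLabelling

/-! ### The nets of the basic pieces. -/

theorem exists_family {X : Type} (s : Multiset X) :
    ∃ (J : Type) (_ : Fintype J) (t : J → X), Finset.univ.val.map t = s := by
  classical
  exact ⟨s, inferInstance, fun x => x.1, Multiset.map_univ_coe s⟩

theorem map_univ_sum {J J' X : Type} [Fintype J] [Fintype J'] (t : J → X) (t' : J' → X) :
    Finset.univ.val.map (Sum.elim t t') =
      Finset.univ.val.map t + Finset.univ.val.map t' := by
  rw [← Finset.univ_disjSum_univ, Finset.val_disjSum, Multiset.map_disjSum]
  rfl

/-- The piece `P` consists of trivalent vertices with the labels `s`, its ends have the labels `w`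
and its interior half-edges the labels `R`. If `F` holds, then different edges inside of `P` have
different labels. -/
def Piece.HasNet {B : Type} (P : Piece B) (s : Multiset (Fin 3 → M)) (w : B → M) (R : Set M)
    (F : Prop) : Prop :=
  ∃ (J : Type) (_ : Fintype J) (t : J → Fin 3 → M), Finset.univ.val.map t = s ∧
    ∃ L : PieceLabelling t w P, (∀ r, r ∈ R ↔ ∃ x, L.label (Sum.inl x) = r) ∧ (F → L.Faithful)

namespace Piece.HasNet

variable {B : Type} {P P' : Piece B} {s s' : Multiset (Fin 3 → M)} {w : B → M} {R : Set M}
  {F F' : Prop} {Γ : NetContext u M}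

theorem presents [Finite B] {J₁ : Type} [Fintype J₁] {t₁ : J₁ → Fin 3 → M} {C : Rest B u}
    (h : P.HasNet s w R F) (hF : F) (S : RestLabelling Γ t₁ w C)
    (hR : ∀ r ∈ R, ∀ y, r ≠ S.label y) :
    Γ.Presents (s + Finset.univ.val.map t₁) (C.fill P) := by
  obtain ⟨J, _, t, rfl, L, hL, hf⟩ := h
  exact ⟨J ⊕ J₁, inferInstance, Sum.elim t t₁, map_univ_sum t t₁,
    ⟨S.fill L (hf hF) fun x => hR _ ((hL _).2 ⟨x, rfl⟩)⟩⟩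

/-- Cutting a piece out of a diagram. -/
theorem excise [Finite B] (h : P.HasNet s w R F) (s₁ : Multiset (Fin 3 → M)) {D : Diagram u}
    (hD : Γ.Presents (s + s₁) D) :
    ∃ C : Rest B u, Γ.value (s + s₁) = C.value P ∧
      ∀ (P' : Piece B) (s' : Multiset (Fin 3 → M)) (F' : Prop), P'.HasNet s' w R F' → F' →
        Γ.value (s' + s₁) = C.value P' := by
  obtain ⟨J, _, t, rfl, L, hL, hf⟩ := h
  obtain ⟨J₁, _, t₁, rfl⟩ := exists_family s₁
  obtain ⟨J₂, _, t₂, ht₂, ⟨S⟩⟩ := hD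
  rw [← map_univ_sum] at ht₂
  obtain ⟨e, he⟩ := exists_equiv_of_map_eq ht₂.symm
  have S' := S.reindex e
  rw [← he] at S'
  have key : ∀ (P' : Piece B) (s' : Multiset (Fin 3 → M)) (F' : Prop), P'.HasNet s' w R F' → F' →
      Γ.value (s' + Finset.univ.val.map t₁) = (S'.rest L).value P' := by
    intro P' s' F' h' hF'
    refine (h'.presents hF' (S'.restLabelling L) fun r hr y => ?_).value_eq
    obtain ⟨x, rfl⟩ := (hL r).1 hr
    exact S'.label_ne L x y
  exact ⟨S'.rest L, key P _ True ⟨J, _, t, rfl, L, hL, fun _ => S'.faithful L⟩ trivial, key⟩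

/-- Pieces with the same labels at the ends and the same set of inner labels fit into the same
rests. So as soon as one of the nets is realised by a diagram, a single rest serves for all of them.
-/
theorem excise_family [Finite B] {ι : Type} {P : ι → Piece B} {s : ι → Multiset (Fin 3 → M)}
    (h : ∀ i, (P i).HasNet (s i) w R True) (s₁ : Multiset (Fin 3 → M)) :
    (∀ i, Γ.value (s i + s₁) = 0) ∨ ∃ C : Rest B u, ∀ i, Γ.value (s i + s₁) = C.value (P i) := by
  by_cases hD : ∃ i D, Γ.Presents (s i + s₁) D
  · obtain ⟨i, D, hD⟩ := hD
    obtain ⟨C, -, hC⟩ := (h i).excise s₁ hD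
    exact Or.inr ⟨C, fun j => hC _ _ _ (h j) trivial⟩
  · exact Or.inl fun i => NetContext.value_eq_zero fun ⟨D, hi⟩ => hD ⟨i, D, hi⟩

theorem rename {B' : Type} (h : P.HasNet s w R F) (σ : B ≃ B') :
    (P.rename σ).HasNet s (w ∘ σ.symm) R F := by
  obtain ⟨J, _, t, rfl, L, hL, hf⟩ := h
  exact ⟨J, _, t, rfl,
    { onH := L.onH.trans (Equiv.sumCongr (Equiv.refl P.I) σ)
      label := L.label ∘ (Equiv.sumCongr (Equiv.refl P.I) σ).symm
      map_vertex := fun j i => by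
        change Equiv.sumCongr (Equiv.refl P.I) σ (P.vertex ((Equiv.sumCongr (Equiv.refl P.I) σ).symm
          (Equiv.sumCongr (Equiv.refl P.I) σ (L.onH (j, i))))) = _
        rw [Equiv.symm_apply_apply, L.map_vertex]
        rfl
      label_net := fun j i => by
        change L.label ((Equiv.sumCongr (Equiv.refl P.I) σ).symm
          (Equiv.sumCongr (Equiv.refl P.I) σ (L.onH (j, i)))) = _
        rw [Equiv.symm_apply_apply, L.label_net]
      label_end := fun b => L.label_end (σ.symm b)
      label_edge := L.label_edge }, hL, hf⟩

/-- The glued ends become inner edges with the labels `wN`, which therefore have to be distinct and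
different from the inner labels of both pieces. -/
theorem glue {A N E : Type} [Finite N] [Nonempty N] {P : Piece (A ⊕ N)} {Q : Piece (N ⊕ E)}
    {wA : A → M} {wN : N → M} {wE : E → M} {R' : Set M}
    (h : P.HasNet s (Sum.elim wA wN) R F) (h' : Q.HasNet s' (Sum.elim wN wE) R' F') :
    (P.glue Q).HasNet (s + s') (Sum.elim wA wE) (R ∪ R' ∪ Set.range wN)
      (F ∧ F' ∧ Disjoint R R' ∧ Disjoint (R ∪ R') (Set.range wN) ∧ Function.Injective wN) := by
  obtain ⟨J, _, t, rfl, L, hL, hf⟩ := h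
  obtain ⟨J', _, t', rfl, L', hL', hf'⟩ := h'
  refine ⟨J ⊕ J', inferInstance, Sum.elim t t', map_univ_sum t t',
    { onH := (Equiv.sumProdDistrib J J' (Fin 3)).trans ((Equiv.sumCongr L.onH L'.onH).trans
        (regroupGlue P.I Q.I A N E).symm)
      label := Sum.elim L.label L'.label ∘ regroupGlue P.I Q.I A N E
      map_vertex := ?_
      label_net := ?_
      label_end := ?_
      label_edge := ?_ }, ?_, ?_⟩
  · rintro (j | j) i
    · change (regroupGlue P.I Q.I A N E).symm (Equiv.sumCongr P.vertex Q.vertex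
        (regroupGlue P.I Q.I A N E ((regroupGlue P.I Q.I A N E).symm
          (Sum.inl (L.onH (j, i)))))) = (regroupGlue P.I Q.I A N E).symm (Sum.inl (L.onH (j, i + 1)))
      rw [Equiv.apply_symm_apply, Equiv.sumCongr_apply, Sum.map_inl, L.map_vertex]
    · change (regroupGlue P.I Q.I A N E).symm (Equiv.sumCongr P.vertex Q.vertex
        (regroupGlue P.I Q.I A N E ((regroupGlue P.I Q.I A N E).symm
          (Sum.inr (L'.onH (j, i)))))) =
          (regroupGlue P.I Q.I A N E).symm (Sum.inr (L'.onH (j, i + 1)))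
      rw [Equiv.apply_symm_apply, Equiv.sumCongr_apply, Sum.map_inr, L'.map_vertex]
  · rintro (j | j) i
    · change Sum.elim L.label L'.label (regroupGlue P.I Q.I A N E
        ((regroupGlue P.I Q.I A N E).symm (Sum.inl (L.onH (j, i))))) = t j i
      rw [Equiv.apply_symm_apply, Sum.elim_inl, L.label_net]
    · change Sum.elim L.label L'.label (regroupGlue P.I Q.I A N E
        ((regroupGlue P.I Q.I A N E).symm (Sum.inr (L'.onH (j, i))))) = t' j i
      rw [Equiv.apply_symm_apply, Sum.elim_inr, L'.label_net]
  · rintro (a | e)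
    · exact L.label_end (Sum.inl a)
    · exact L'.label_end (Sum.inr e)
  · rintro ((x | x) | (n | n))
    · exact L.label_edge x
    · exact L'.label_edge x
    · exact (L'.label_end (Sum.inl n)).trans (L.label_end (Sum.inr n)).symm
    · exact (L.label_end (Sum.inr n)).trans (L'.label_end (Sum.inl n)).symm
  · intro r
    rw [Set.mem_union, Set.mem_union, hL, hL']
    constructor
    · rintro ((⟨x, rfl⟩ | ⟨x, rfl⟩) | ⟨n, rfl⟩)
      · exact ⟨Sum.inl (Sum.inl x), rfl⟩
      · exact ⟨Sum.inl (Sum.inr x), rfl⟩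
      · exact ⟨Sum.inr (Sum.inl n), L.label_end (Sum.inr n)⟩
    · rintro ⟨(x | x) | (n | n), rfl⟩
      · exact Or.inl (Or.inl ⟨x, rfl⟩)
      · exact Or.inl (Or.inr ⟨x, rfl⟩)
      · exact Or.inr ⟨n, (L.label_end (Sum.inr n)).symm⟩
      · exact Or.inr ⟨n, (L'.label_end (Sum.inl n)).symm⟩
  · rintro ⟨hF, hF', hd, hd', hi⟩
    have h1 : ∀ x y, L.label (Sum.inl x) ≠ L'.label (Sum.inl y) := fun x y h =>
      Set.disjoint_left.1 hd ((hL _).2 ⟨x, rfl⟩) ((hL' _).2 ⟨y, h.symm⟩)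
    have h2 : ∀ x n, L.label (Sum.inl x) ≠ wN n := fun x n h =>
      Set.disjoint_left.1 hd' (Or.inl ((hL _).2 ⟨x, rfl⟩)) ⟨n, h.symm⟩
    have h3 : ∀ x n, L'.label (Sum.inl x) ≠ wN n := fun x n h =>
      Set.disjoint_left.1 hd' (Or.inr ((hL' _).2 ⟨x, rfl⟩)) ⟨n, h.symm⟩
    have h4 : ∀ n, L.label (Sum.inr (Sum.inr n)) = wN n := fun n => L.label_end (Sum.inr n)
    have h5 : ∀ n, L'.label (Sum.inr (Sum.inl n)) = wN n := fun n => L'.label_end (Sum.inl n)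
    rintro ((x | x) | (n | n)) ((y | y) | (n' | n')) h
    · change L.label (Sum.inl x) = L.label (Sum.inl y) at h
      exact (hf hF x y h).imp (congrArg fun z => Sum.inl (Sum.inl z))
        (congrArg fun z => Sum.inl (Sum.inl z))
    · exact absurd h (h1 x y)
    · exact absurd (h.trans (h4 n')) (h2 x n')
    · exact absurd (h.trans (h5 n')) (h2 x n')
    · exact absurd h.symm (h1 y x)
    · change L'.label (Sum.inl x) = L'.label (Sum.inl y) at h
      exact (hf' hF' x y h).imp (congrArg fun z => Sum.inl (Sum.inr z))
        (congrArg fun z => Sum.inl (Sum.inr z))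
    · exact absurd (h.trans (h4 n')) (h3 x n')
    · exact absurd (h.trans (h5 n')) (h3 x n')
    · exact absurd (h.symm.trans (h4 n)) (h2 y n)
    · exact absurd (h.symm.trans (h4 n)) (h3 y n)
    · exact Or.inl (congrArg (fun z => Sum.inr (Sum.inl z))
        (hi ((h4 n).symm.trans (h.trans (h4 n'))).symm))
    · exact Or.inr (congrArg (fun z => Sum.inr (Sum.inr z))
        (hi ((h4 n).symm.trans (h.trans (h5 n'))).symm))
    · exact absurd (h.symm.trans (h5 n)) (h2 y n)
    · exact absurd (h.symm.trans (h5 n)) (h3 y n)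
    · exact Or.inr (congrArg (fun z => Sum.inr (Sum.inl z))
        (hi ((h5 n).symm.trans (h.trans (h4 n'))).symm))
    · exact Or.inl (congrArg (fun z => Sum.inr (Sum.inr z))
        (hi ((h5 n).symm.trans (h.trans (h5 n'))).symm))

end Piece.HasNet

/-- The vertices of a net as a multiset. -/
def netMultiset {X : Type*} (s : List (X × X × X)) : Multiset (Fin 3 → X) :=
  ↑(s.map fun t => ![t.1, t.2.1, t.2.2])

theorem netMultiset_append {X : Type*} (s t : List (X × X × X)) :
    netMultiset (s ++ t) = netMultiset s + netMultiset t := by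
  rw [netMultiset, List.map_append]
  rfl

/-- The labels of the edges inside of a ladder. -/
def ladderLabels (r : M) (ls : List (M × M × M)) : List M := netLabels ls ++ [r]

namespace Piece.HasNet

variable {B : Type} {P : Piece B} {s s' : Multiset (Fin 3 → M)} {w : B → M} {R R' : Set M}
  {F F' : Prop}

theorem congr (h : P.HasNet s w R F) (hs : s = s') (hR : R = R') (hF : F' → F) :
    P.HasNet s' w R' F' := by
  subst hs hR
  obtain ⟨J, _, t, rfl, L, hL, hf⟩ := h
  exact ⟨J, _, t, rfl, L, hL, hf ∘ hF⟩

/-- The cyclic order at a trivalent vertex has no first element. -/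
theorem tripod_rotate (w : Fin 3 → M) (r : Fin 3) :
    tripod.HasNet {fun i => w (i + r)} w ∅ True := by
  refine ⟨Unit, inferInstance, fun _ i => w (i + r), rfl,
    { onH := (Equiv.punitProd (Fin 3)).trans ((Equiv.addRight r).trans (Equiv.emptySum Empty _).symm)
      label := Sum.elim Empty.elim w
      map_vertex := fun j i => ?_
      label_net := fun j i => rfl
      label_end := fun b => rfl
      label_edge := fun x => x.elim }, ?_, fun _ x => x.elim⟩
  · change Sum.inr (finRotate 3 (i + r)) = Sum.inr (i + 1 + r)
    rw [finRotate_apply, add_right_comm]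
  · exact fun r => ⟨fun h => h.elim, fun ⟨x, _⟩ => x.elim⟩

theorem tripod (a b c : M) : tripod.HasNet (netMultiset [(a, b, c)]) ![a, b, c] ∅ True := by
  refine (tripod_rotate ![a, b, c] 0).congr ?_ rfl id
  simp [netMultiset]

/-- The half-edges of a rung. -/
def rungEquiv : Fin 2 × Fin 3 ≃ Fin 2 ⊕ Ends where
  toFun
    | (0, 0) => Sum.inl 0
    | (0, 1) => Sum.inr tl
    | (0, 2) => Sum.inr bl
    | (1, 0) => Sum.inl 1
    | (1, 1) => Sum.inr br
    | (1, 2) => Sum.inr tr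
  invFun
    | Sum.inl 0 => (0, 0)
    | Sum.inr (Sum.inl 0) => (0, 1)
    | Sum.inr (Sum.inr 0) => (0, 2)
    | Sum.inl 1 => (1, 0)
    | Sum.inr (Sum.inr 1) => (1, 1)
    | Sum.inr (Sum.inl 1) => (1, 2)
  left_inv := by decide
  right_inv := by decide

theorem rung (w : Ends → M) (e : M) :
    rung.HasNet (netMultiset (rungNet (w tl) (w tr) (w bl) (w br) e)) w {e} True := by
  refine ⟨Fin 2, inferInstance, ![![e, w tl, w bl], ![e, w br, w tr]], rfl,
    { onH := rungEquiv
      label := Sum.elim (fun _ => e) w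
      map_vertex := show ∀ (j : Fin 2) (i : Fin 3),
        rungVertex (rungEquiv (j, i)) = rungEquiv (j, i + 1) by decide
      label_net := ?_
      label_end := fun b => rfl
      label_edge := fun x => rfl }, ?_, ?_⟩
  · intro j i
    fin_cases j <;> fin_cases i <;> rfl
  · intro r
    exact ⟨fun h => ⟨(0 : Fin 2), h.symm⟩, fun ⟨_, h⟩ => h.symm⟩
  · intro _ x y _
    have : ∀ x y : Fin 2, y = x ∨ y = Equiv.swap 0 1 x := by decide
    exact this x y

theorem ladder (r : M) (ls : List (M × M × M)) (w : Ends → M) :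
    (ladder (ls.length + 1)).HasNet
      (netMultiset (ladderNet r ls (w tl) (w tr) (w bl) (w br))) w
      {x | x ∈ ladderLabels r ls} (ladderLabels r ls).Nodup := by
  induction ls generalizing w with
  | nil =>
    refine (rung w r).congr rfl ?_ fun _ => trivial
    ext x
    simp [ladderLabels, netLabels]
  | cons h ls ih =>
    obtain ⟨m, m', r'⟩ := h
    have h1 := ih (Sum.elim ![w tl, w tr] ![m, m'])
    have h2 := rung (Sum.elim ![m, m'] ![w bl, w br]) r'
    have h3 := h1.glue h2
    rw [show Sum.elim ![w tl, w tr] ![w bl, w br] = w by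
      ext (i | i) <;> fin_cases i <;> rfl] at h3
    refine h3.congr ?_ ?_ ?_
    · rw [← netMultiset_append]
      rfl
    · ext x
      simp [ladderLabels, netLabels]
      rw [or_left_comm]
    · intro h
      simp only [ladderLabels, netLabels, List.flatMap_cons, List.cons_append, List.nil_append,
        List.nodup_cons, List.mem_cons, not_or] at h
      obtain ⟨⟨h01, h02, h03⟩, ⟨h04, h05⟩, h06, h07⟩ := h
      refine ⟨h07, trivial, ?_, ?_, ?_⟩
      · rw [Set.disjoint_singleton_right]
        exact h06
      · rw [Set.disjoint_right]
        rintro _ ⟨i, rfl⟩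
        fin_cases i
        · exact fun h => h.elim h03 h02
        · exact fun h => h.elim h05 h04
      · intro i j hij
        fin_cases i <;> fin_cases j
        · rfl
        · exact absurd hij h01
        · exact absurd hij.symm h01
        · rfl

/-- `False` suffices as last argument: the piece of (x) is only ever cut out of a given diagram, so
its inner labels need not be known to be distinct. -/
theorem xPiece (r : M) (ls : List (M × M × M)) (a c e e' z : M) :
    ∃ R, (xPiece (ls.length + 1)).HasNet (netMultiset (ladderNet r ls a e c e' ++ [(e, e', z)]))
      (Sum.elim ![a, c] ![z]) R False := by
  have h1 := (ladder r ls (Sum.elim ![a, e] ![c, e'])).rename sideways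
  have h2 := (tripod e e' z).rename (finSumFinEquiv (m := 2) (n := 1)).symm
  rw [show Sum.elim ![a, e] ![c, e'] ∘ sideways.symm = Sum.elim ![a, c] ![e, e'] by
    ext (i | i) <;> fin_cases i <;> rfl] at h1
  rw [show ![e, e', z] ∘ (finSumFinEquiv (m := 2) (n := 1)).symm.symm = Sum.elim ![e, e'] ![z] by
    ext (i | i) <;> fin_cases i <;> rfl] at h2
  refine ⟨_, (h1.glue h2).congr ?_ rfl False.elim⟩
  rw [netMultiset_append]
  rfl

end Piece.HasNet

/-! ### Renaming inner edges of a net. -/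

theorem countP_netLabels {X : Type} [DecidableEq X] (x : X) (s : List (X × X × X)) :
    (netLabels s).countP (· = x) = (Finset.univ.filter fun p : Fin s.length × Fin 3 =>
      ![(s.get p.1).1, (s.get p.1).2.1, (s.get p.1).2.2] p.2 = x).card := by
  rw [Finset.card_filter, Fintype.sum_prod_type, netLabels, List.countP_flatMap, ← List.sum_ofFn]
  conv_lhs => rw [← List.ofFn_get s, List.map_ofFn]
  congr 2
  funext j
  simp only [Function.comp_apply, Fin.sum_univ_three, List.countP_cons, List.countP_nil]
  rw [zero_add, add_comm, ← add_assoc, add_right_comm]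
  simp only [decide_eq_true_eq]
  congr

theorem netMultiset_map {X Y : Type} (ψ : X → Y) (s : List (X × X × X)) :
    Finset.univ.val.map (fun j : Fin s.length =>
      ψ ∘ ![(s.get j).1, (s.get j).2.1, (s.get j).2.2]) = netMultiset (netMap ψ s) := by
  conv_rhs => rw [← List.map_get_finRange s]
  rw [netMultiset, netMap, List.map_map, List.map_map]
  change Multiset.map _ (Multiset.ofList (List.finRange s.length)) = _
  rw [Multiset.map_coe]
  congr 2
  funext j i
  fin_cases i <;> rfl

namespace DiagramLabelling

variable {Γ : NetContext u M} {J₀ J₁ X : Type} {t₀ : J₀ → Fin 3 → X} {t₁ : J₁ → Fin 3 → M}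
  {ψ : X → M} {D : Diagram u}

/-- The label in `X` of a half-edge. -/
def kind (S : DiagramLabelling Γ (Sum.elim (fun j => ψ ∘ t₀ j) t₁) D) : D.H ⊕ D.U → Option X
  | Sum.inl h => (S.onH.symm h).elim
      (fun p => p.1.elim (fun j => some (t₀ j p.2)) fun _ => none) fun _ => none
  | Sum.inr _ => none

variable (S : DiagramLabelling Γ (Sum.elim (fun j => ψ ∘ t₀ j) t₁) D)

theorem kind_net (j : J₀) (i : Fin 3) :
    S.kind (Sum.inl (S.onH (Sum.inl (Sum.inl j, i)))) = some (t₀ j i) := by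
  simp [kind]

theorem kind_net' (j : J₁) (i : Fin 3) :
    S.kind (Sum.inl (S.onH (Sum.inl (Sum.inr j, i)))) = none := by
  simp [kind]

theorem kind_K (x : Γ.K) : S.kind (Sum.inl (S.onH (Sum.inr x))) = none := by
  simp [kind]

theorem label_of_kind {z : D.H ⊕ D.U} {x : X} (h : S.kind z = some x) : S.label z = ψ x := by
  rcases z with z | z
  · obtain ⟨(⟨j | j, i⟩ | y), rfl⟩ := S.onH.surjective z
    · rw [kind_net, Option.some.injEq] at h
      rw [S.label_net, ← h]
      rfl
    · rw [kind_net'] at h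
      cases h
    · rw [kind_K] at h
      cases h
  · cases h

/-- The labels after a permutation of `X`. -/
def permLabel (τ : Equiv.Perm X) (z : D.H ⊕ D.U) : M := (S.kind z).elim (S.label z) (ψ ∘ τ)

variable {S}

theorem permLabel_of_kind {τ : Equiv.Perm X} {z : D.H ⊕ D.U} {x : X} (h : S.kind z = some x) :
    S.permLabel τ z = ψ (τ x) := by
  rw [permLabel, h]
  rfl

theorem permLabel_of_none {τ : Equiv.Perm X} {z : D.H ⊕ D.U} (h : S.kind z = none) :
    S.permLabel τ z = S.label z := by
  rw [permLabel, h]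
  rfl

/-- An edge has only two half-edges, so two occurrences of `x` in the subnet exhaust the label `ψ
x`. -/
theorem kind_eq_of_label_eq {x : X} (hx : ∃ z z', z ≠ z' ∧ S.kind z = some x ∧ S.kind z' = some x)
    {z : D.H ⊕ D.U} (hz : S.label z = ψ x) : S.kind z = some x := by
  obtain ⟨z₁, z₂, hne, h₁, h₂⟩ := hx
  rw [← S.label_of_kind h₁, eq_comm, S.label_eq] at hz
  have h := (S.label_of_kind h₁).trans (S.label_of_kind h₂).symm
  rw [S.label_eq] at h
  rcases hz with rfl | rfl
  · exact h₁
  · rwa [← h.resolve_left hne.symm]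

/-- With `x` also `τ x` is moved, so both edges lie entirely in the subnet. The new label therefore
cannot collide with one from outside. -/
theorem permLabel_eq_of_moved {τ : Equiv.Perm X}
    (hτ : ∀ x, τ x ≠ x → ∃ z z', z ≠ z' ∧ S.kind z = some x ∧ S.kind z' = some x)
    {z z' : D.H ⊕ D.U} {x : X} (hz : S.kind z = some x) (hx : τ x ≠ x) :
    S.permLabel τ z = S.permLabel τ z' ↔ S.label z = S.label z' := by
  have hy : τ (τ x) ≠ τ x := fun h => hx (τ.injective h)
  constructor
  · intro h
    rw [permLabel_of_kind hz] at h
    rcases h' : S.kind z' with _ | x'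
    · rw [permLabel_of_none h'] at h
      rw [kind_eq_of_label_eq (hτ _ hy) h.symm] at h'
      cases h'
    · rw [permLabel_of_kind h'] at h
      by_cases hx' : τ x' = x'
      · rw [hx', ← S.label_of_kind h'] at h
        rw [kind_eq_of_label_eq (hτ _ hy) h.symm, Option.some.injEq] at h'
        exact absurd (h' ▸ hx') hy
      · obtain ⟨z₂, _, _, h₂, _⟩ := hτ (τ x') fun h => hx' (τ.injective h)
        rw [← S.label_of_kind h₂] at h
        rw [kind_eq_of_label_eq (hτ _ hy) h.symm, Option.some.injEq] at h₂
        rw [S.label_of_kind hz, S.label_of_kind h', τ.injective h₂]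
  · intro h
    rw [S.label_of_kind hz] at h
    rw [permLabel_of_kind hz, permLabel_of_kind (kind_eq_of_label_eq (hτ _ hx) h.symm)]

/-- A permutation of labels that occur on both halves of an edge does not change the diagram. -/
def permute {τ : Equiv.Perm X}
    (hτ : ∀ x, τ x ≠ x → ∃ z z', z ≠ z' ∧ S.kind z = some x ∧ S.kind z' = some x) :
    DiagramLabelling Γ (Sum.elim (fun j => (ψ ∘ τ) ∘ t₀ j) t₁) D where
  onH := S.onH
  onU := S.onU
  label := S.permLabel τ
  map_vertex_inl := S.map_vertex_inl
  map_vertex_inr := S.map_vertex_inr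
  map_color := S.map_color
  label_net j i := by
    rcases j with j | j
    · exact permLabel_of_kind (S.kind_net j i)
    · exact (permLabel_of_none (S.kind_net' j i)).trans (S.label_net _ i)
  label_K x := (permLabel_of_none (S.kind_K x)).trans (S.label_K x)
  label_U v := (permLabel_of_none rfl).trans (S.label_U v)
  label_eq z z' := by
    rw [← S.label_eq]
    have h : ∀ z, (∃ x, S.kind z = some x ∧ τ x ≠ x) ∨ S.permLabel τ z = S.label z := by
      intro z
      rcases hz : S.kind z with _ | x
      · exact Or.inr (permLabel_of_none hz)
      · by_cases hx : τ x = x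
        · exact Or.inr (by rw [permLabel_of_kind hz, hx, S.label_of_kind hz])
        · exact Or.inl ⟨x, rfl, hx⟩
    rcases h z with ⟨x, hz, hx⟩ | hz
    · exact permLabel_eq_of_moved hτ hz hx
    · rcases h z' with ⟨x, hz', hx⟩ | hz'
      · rw [eq_comm, permLabel_eq_of_moved hτ hz' hx, eq_comm]
      · rw [hz, hz']

end DiagramLabelling

theorem NetContext.presents_permute {Γ : NetContext u M} {X : Type} [DecidableEq X] (ψ : X → M)
    (τ : Equiv.Perm X) (s : List (X × X × X))
    (h : ∀ x, τ x ≠ x → 2 ≤ (netLabels s).countP (· = x)) (s₁ : Multiset (Fin 3 → M))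
    {D : Diagram u} (hD : Γ.Presents (netMultiset (netMap ψ s) + s₁) D) :
    Γ.Presents (netMultiset (netMap (ψ ∘ τ) s) + s₁) D := by
  obtain ⟨J₁, _, t₁, rfl⟩ := exists_family s₁
  obtain ⟨J, _, t, ht, ⟨S⟩⟩ := hD
  rw [← netMultiset_map, ← map_univ_sum] at ht
  obtain ⟨e, he⟩ := exists_equiv_of_map_eq ht.symm
  have S' := S.reindex e
  rw [← he] at S'
  refine ⟨_, inferInstance, _, ?_, ⟨S'.permute (τ := τ) fun x hx => ?_⟩⟩
  · rw [map_univ_sum, netMultiset_map]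
  · have h' := h x hx
    rw [countP_netLabels, ← Nat.lt_iff_add_one_le, Finset.one_lt_card] at h'
    obtain ⟨⟨j, i⟩, h₁, ⟨j', i'⟩, h₂, hne⟩ := h'
    rw [Finset.mem_filter] at h₁ h₂
    refine ⟨Sum.inl (S'.onH (Sum.inl (Sum.inl j, i))), Sum.inl (S'.onH (Sum.inl (Sum.inl j', i'))),
      ?_, ?_, ?_⟩
    · simpa using hne
    · rw [S'.kind_net]
      exact congrArg some h₁.2
    · rw [S'.kind_net]
      exact congrArg some h₂.2

theorem NetContext.value_permute {Γ : NetContext u M} {X : Type} [DecidableEq X] (ψ : X → M)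
    (τ : Equiv.Perm X) (s : List (X × X × X))
    (h : ∀ x, τ x ≠ x → 2 ≤ (netLabels s).countP (· = x)) (s₁ : Multiset (Fin 3 → M)) :
    Γ.value (netMultiset (netMap ψ s) + s₁) = Γ.value (netMultiset (netMap (ψ ∘ τ) s) + s₁) := by
  refine NetContext.value_congr fun D => ⟨presents_permute ψ τ s h s₁, fun hD => ?_⟩
  have h' := presents_permute (ψ ∘ τ) τ⁻¹ s (fun x hx => h x fun hτ => hx ?_) s₁ hD
  · rwa [Function.comp_assoc, ← Equiv.Perm.coe_mul, mul_inv_cancel, Equiv.Perm.coe_one,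
      Function.comp_id] at h'
  · rw [Equiv.Perm.inv_eq_iff_eq, hτ]

/-! ### The algebra of nets modulo local relations. -/

namespace Rest

variable {B : Type} [Finite B]

theorem value_antisymm (C : Rest (Fin 3) u) :
    C.value tripod + C.value (tripod.rename (Equiv.swap 0 1)) = 0 :=
  (Submodule.Quotient.mk_eq_zero _).2 (Submodule.subset_span (IsRelation.antisymmetry C))

theorem value_ihx (C : Rest Ends u) :
    C.value (rung.rename quarterTurn) -
      (C.value rung - C.value (rung.rename (Equiv.swap bl br))) = 0 :=
  (Submodule.Quotient.mk_eq_zero _).2 (Submodule.subset_span (IsRelation.ihx C))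

theorem value_xPiece {n : ℕ} (hn : 1 ≤ n) (C : Rest (Fin 2 ⊕ Fin 1) u) :
    C.value (xPiece n) = 0 :=
  (Submodule.Quotient.mk_eq_zero _).2 (Submodule.subset_span (IsRelation.x n hn C))

end Rest

namespace NetContext

variable (Γ : NetContext u M)

/-- Formal linear combinations of nets. -/
abbrev FormalNets (M : Type) : Type := AddMonoidAlgebra ℚ (Multiset (Fin 3 → M))

/-- The formal linear combination of one net. -/
noncomputable abbrev formal (s : Multiset (Fin 3 → M)) : FormalNets M := AddMonoidAlgebra.single s 1

/-- The linear extension of `value`. -/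
noncomputable def valueLinear : FormalNets M →ₗ[ℚ] BHat u :=
  Finsupp.linearCombination ℚ Γ.value ∘ₗ (AddMonoidAlgebra.coeffLinearEquiv ℚ).toLinearMap

theorem valueLinear_single (s : Multiset (Fin 3 → M)) (r : ℚ) :
    Γ.valueLinear (AddMonoidAlgebra.single s r) = r • Γ.value s :=
  Finsupp.linearCombination_single ℚ r s

/-- The linear combinations of nets that vanish, whatever one adds to them. -/
noncomputable def nullIdeal : Ideal (FormalNets M) where
  -- The factor `q` stands for the vertices outside a local move. This is the largest ideal on which
  -- `valueLinear` vanishes, so `valueLinear` descends to the quotient ring.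
  carrier := {p | ∀ q, Γ.valueLinear (q * p) = 0}
  zero_mem' q := by rw [mul_zero, map_zero]
  add_mem' hp hp' q := by rw [mul_add, map_add, hp q, hp' q, add_zero]
  smul_mem' c p hp q := by rw [smul_eq_mul, ← mul_assoc, hp]

/-- The algebra of nets modulo the relations that hold in every diagram. -/
abbrev NetQuotient : Type := FormalNets M ⧸ Γ.nullIdeal

/-- The value of a linear combination of nets. -/
noncomputable def eval : Γ.NetQuotient →ₗ[ℚ] BHat u :=
  (Submodule.liftQ (Γ.nullIdeal.restrictScalars ℚ) Γ.valueLinear fun p hp => by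
    simpa using (show ∀ q, Γ.valueLinear (q * p) = 0 from hp) 1) ∘ₗ
    (Submodule.Quotient.restrictScalarsEquiv ℚ Γ.nullIdeal).symm.toLinearMap

/-- The class of a net. -/
noncomputable def net (s : Multiset (Fin 3 → M)) : Γ.NetQuotient :=
  Ideal.Quotient.mk Γ.nullIdeal (formal s)

theorem eval_net (s : Multiset (Fin 3 → M)) : Γ.eval (Γ.net s) = Γ.value s := by
  change Γ.valueLinear (formal s) = _
  rw [valueLinear_single, one_smul]

theorem net_add (s s' : Multiset (Fin 3 → M)) : Γ.net (s + s') = Γ.net s * Γ.net s' := by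
  rw [net, net, net, ← map_mul, formal, formal, formal, AddMonoidAlgebra.single_mul_single, one_mul]

/-- A linear relation between nets that holds in every diagram. -/
theorem sum_net_eq_zero {ι : Type} [Fintype ι] (c : ι → ℚ) (s : ι → Multiset (Fin 3 → M))
    (h : ∀ s₁, ∑ i, c i • Γ.value (s i + s₁) = 0) : ∑ i, c i • Γ.net (s i) = 0 := by
  have h1 : ∑ i, c i • formal (s i) ∈ Γ.nullIdeal := by
    intro q
    induction q using AddMonoidAlgebra.induction_linear with
    | zero => rw [zero_mul, map_zero]
    | add p q hp hq => rw [add_mul, map_add, hp, hq, add_zero]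
    | single s₁ r =>
      rw [Finset.mul_sum, map_sum]
      simp only [mul_smul_comm, AddMonoidAlgebra.single_mul_single, map_smul, valueLinear_single,
        mul_one]
      rw [← smul_zero r, ← h s₁, Finset.smul_sum]
      refine Finset.sum_congr rfl fun i _ => ?_
      rw [smul_comm, add_comm]
  have h2 := Ideal.Quotient.eq_zero_iff_mem.2 h1
  rw [map_sum] at h2
  exact h2

theorem net_eq_net {s s' : Multiset (Fin 3 → M)} (h : ∀ s₁, Γ.value (s + s₁) = Γ.value (s' + s₁)) :
    Γ.net s = Γ.net s' := by
  have := Γ.sum_net_eq_zero ![1, -1] ![s, s'] fun s₁ => by simp [h]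
  simpa [← sub_eq_add_neg, sub_eq_zero] using this

theorem net_eq_zero {s : Multiset (Fin 3 → M)} (h : ∀ s₁, Γ.value (s + s₁) = 0) : Γ.net s = 0 := by
  have := Γ.sum_net_eq_zero ![1] ![s] fun s₁ => by simp [h]
  simpa using this

/-- A linear relation between pieces. -/
theorem sum_piece_eq_zero {B ι : Type} [Finite B] [Fintype ι] (c : ι → ℚ) {P : ι → Piece B}
    {s : ι → Multiset (Fin 3 → M)} {w : B → M} {R : Set M}
    (h : ∀ i, (P i).HasNet (s i) w R True)
    (hP : ∀ C : Rest B u, ∑ i, c i • C.value (P i) = 0) : ∑ i, c i • Γ.net (s i) = 0 := by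
  refine Γ.sum_net_eq_zero c s fun s₁ => ?_
  rcases Piece.HasNet.excise_family (Γ := Γ) h s₁ with h' | ⟨C, h'⟩
  · simp [h']
  · simpa [h'] using hP C

theorem netProd_net (s : List (M × M × M)) :
    netProd (fun a b c => Γ.net {![a, b, c]}) s = Γ.net (netMultiset s) := by
  induction s with
  | nil => exact (map_one _).symm
  | cons t s ih =>
    change Γ.net _ * netProd (fun a b c => Γ.net {![a, b, c]}) s = _
    rw [ih, ← net_add]
    rfl

theorem net_piece_congr {B : Type} [Finite B] {P : Piece B} {s s' : Multiset (Fin 3 → M)}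
    {w : B → M} {R : Set M} (h : P.HasNet s w R True) (h' : P.HasNet s' w R True) :
    Γ.net s = Γ.net s' := by
  have := Γ.sum_piece_eq_zero ![1, -1] (P := fun _ => P) (s := ![s, s']) (w := w) (R := R)
    (fun i => by fin_cases i <;> assumption) fun C => by simp
  simpa [← sub_eq_add_neg, sub_eq_zero] using this

theorem net_rot (a b c : M) : Γ.net {![a, b, c]} = Γ.net {![b, c, a]} := by
  have h1 := Piece.HasNet.tripod_rotate ![a, b, c] 0
  have h2 := Piece.HasNet.tripod_rotate ![a, b, c] 1
  convert Γ.net_piece_congr h1 h2 using 3 <;> funext i <;> fin_cases i <;> rfl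

theorem net_anti (a b c : M) : Γ.net {![a, b, c]} = -Γ.net {![b, a, c]} := by
  have h1 := Piece.HasNet.tripod a b c
  have h2 := (Piece.HasNet.tripod b a c).rename (Equiv.swap 0 1)
  rw [show ![b, a, c] ∘ (Equiv.swap 0 1).symm = ![a, b, c] by
    ext i; fin_cases i <;> rfl] at h2
  have := Γ.sum_piece_eq_zero ![1, 1] (P := ![tripod, tripod.rename (Equiv.swap 0 1)])
    (s := ![netMultiset [(a, b, c)], netMultiset [(b, a, c)]])
    (fun i => by fin_cases i <;> assumption) fun C => by simpa using C.value_antisymm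
  rw [← add_eq_zero_iff_eq_neg]
  simp only [Fin.sum_univ_two, Matrix.cons_val_zero, Matrix.cons_val_one, one_smul] at this
  exact this

theorem net_rung (a b c d e : M) :
    Γ.net (netMultiset (rungNet a b c d e)) = Γ.net {![e, a, c]} * Γ.net {![e, d, b]} := by
  rw [← net_add]
  rfl

theorem net_ihx (e a b c d : M) :
    Γ.net {![e, a, b]} * Γ.net {![e, c, d]} + Γ.net {![e, b, c]} * Γ.net {![e, a, d]} +
      Γ.net {![e, c, a]} * Γ.net {![e, b, d]} = 0 := by
  have h1 := Piece.HasNet.rung (Sum.elim ![a, b] ![c, d]) e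
  have h2 := (Piece.HasNet.rung (Sum.elim ![c, a] ![d, b]) e).rename quarterTurn
  have h3 := (Piece.HasNet.rung (Sum.elim ![a, b] ![d, c]) e).rename (Equiv.swap bl br)
  rw [show Sum.elim ![c, a] ![d, b] ∘ quarterTurn.symm = Sum.elim ![a, b] ![c, d] by
    ext (i | i) <;> fin_cases i <;> rfl] at h2
  rw [show Sum.elim ![a, b] ![d, c] ∘ (Equiv.swap bl br).symm = Sum.elim ![a, b] ![c, d] by
    ext (i | i) <;> fin_cases i <;> rfl] at h3
  have h4 := Γ.sum_piece_eq_zero ![1, -1, 1]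
    (P := ![rung.rename quarterTurn, rung, rung.rename (Equiv.swap bl br)])
    (s := ![netMultiset (rungNet c a d b e), netMultiset (rungNet a b c d e),
      netMultiset (rungNet a b d c e)])
    (fun i => by
      fin_cases i
      · exact h2
      · exact h1
      · exact h3) fun C => by
      rw [← C.value_ihx]
      simp only [Fin.sum_univ_three, Matrix.cons_val_zero, Matrix.cons_val_one, Matrix.cons_val,
        one_smul, neg_smul]
      abel
  simp only [Fin.sum_univ_three, Matrix.cons_val_zero, Matrix.cons_val_one, Matrix.cons_val,
    one_smul, neg_smul, net_rung] at h4
  have flip : ∀ x y, Γ.net {![e, x, y]} = -Γ.net {![e, y, x]} := fun x y => by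
    rw [Γ.net_anti, Γ.net_rot x e y]
  rw [flip a b, flip c a, flip b c, flip b d]
  linear_combination -h4

/-- The algebra of nets in a fixed context. -/
noncomputable def netAlgebra : NetAlgebra M Γ.NetQuotient where
  f a b c := Γ.net {![a, b, c]}
  rot := Γ.net_rot
  anti := Γ.net_anti
  ihx := Γ.net_ihx
  loop r ls a c e e' z := by
    obtain ⟨R, h⟩ := Piece.HasNet.xPiece r ls a c e e' z
    have h1 : netProd (fun a b c => Γ.net {![a, b, c]}) (ladderNet r ls a e c e') *
        Γ.net {![e, e', z]} = Γ.net (netMultiset (ladderNet r ls a e c e' ++ [(e, e', z)])) := by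
      rw [netProd_net, netMultiset_append, net_add]
      rfl
    rw [h1]
    refine Γ.net_eq_zero fun s₁ => ?_
    -- Nets that no diagram realises have value zero by definition, so only the remaining ones need
    -- relation (x).
    by_cases hD : ∃ D, Γ.Presents (netMultiset (ladderNet r ls a e c e' ++ [(e, e', z)]) + s₁) D
    · obtain ⟨D, hD⟩ := hD
      obtain ⟨C, hC, -⟩ := h.excise s₁ hD
      rw [hC, C.value_xPiece (Nat.le_add_left 1 _)]
    · exact value_eq_zero hD
  relabel ψ τ s h := by
    rw [netProd_net, netProd_net]
    exact Γ.net_eq_net (value_permute ψ τ s h)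

end NetContext

/-! ### Labelling a given rest by its edges. -/

namespace Rest

variable {B : Type} (C : Rest B u)

/-- Labels for the edges outside of a piece, and infinitely many more labels. -/
abbrev Label : Type := Sym2 (B ⊕ (C.K ⊕ C.U)) ⊕ ℕ

/-- The label of a half-edge outside of a piece. -/
def edgeLabel (y : B ⊕ (C.K ⊕ C.U)) : C.Label := Sum.inl s(y, C.edge y)

theorem edgeLabel_eq (x y : B ⊕ (C.K ⊕ C.U)) :
    C.edgeLabel x = C.edgeLabel y ↔ y = x ∨ y = C.edge x := by
  rw [edgeLabel, edgeLabel, Sum.inl.injEq, Sym2.eq_iff]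
  constructor
  · rintro (⟨h, -⟩ | ⟨-, h⟩)
    · exact Or.inl h.symm
    · exact Or.inr h.symm
  · rintro (rfl | rfl)
    · exact Or.inl ⟨rfl, rfl⟩
    · exact Or.inr ⟨(C.edge_edge x).symm, rfl⟩

/-- The label of an end. -/
def place (b : B) : C.Label := C.edgeLabel (Sum.inl b)

/-- The rest of a diagram as a context for nets. -/
def context : NetContext u C.Label where
  K := C.K
  U := C.U
  finite_K := C.finite_K
  finite_U := C.finite_U
  vertex := C.vertex
  vertex_cube := C.vertex_cube
  vertex_ne := C.vertex_ne
  color := C.color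
  card_color := C.card_color
  label x := C.edgeLabel (Sum.inr x)

/-- The rest of a diagram, labelled by its edges. -/
def labelling : RestLabelling C.context (Empty.elim : Empty → Fin 3 → C.Label) C.place C where
  onK := Equiv.emptySum _ _
  onU := Equiv.refl _
  label := C.edgeLabel
  map_vertex_inl j := j.elim
  map_vertex_inr _ := rfl
  map_color _ := rfl
  label_end _ := rfl
  label_net j := j.elim
  label_K _ := rfl
  label_U _ := rfl
  label_eq := C.edgeLabel_eq

/-- The value of a piece is the value of its net. -/
theorem value_eq_eval [Finite B] {P : Piece B} {l : List (C.Label × C.Label × C.Label)}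
    {R : Set C.Label} {F : Prop} (h : P.HasNet (netMultiset l) C.place R F) (hF : F)
    (hR : ∀ r ∈ R, ∃ i, r = Sum.inr i) :
    C.value P = C.context.eval (netProd C.context.netAlgebra.f l) := by
  have h1 := (h.presents hF C.labelling fun r hr y => by
    obtain ⟨i, rfl⟩ := hR r hr
    exact Sum.inr_ne_inl).value_eq
  rw [show (Finset.univ.val.map (Empty.elim : Empty → Fin 3 → C.Label)) = 0 from rfl,
    add_zero] at h1
  rw [show C.context.netAlgebra.f = fun a b c => C.context.net {![a, b, c]} from rfl,
    NetContext.netProd_net, NetContext.eval_net, h1]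
  rfl

end Rest

/-- The bounds on `i` allow several ladders to receive disjoint labels, by shifting the offset `o`.
-/
theorem exists_fresh {X : Type} (k o : ℕ) : ∃ (r : X ⊕ ℕ) (ls : List ((X ⊕ ℕ) × (X ⊕ ℕ) × (X ⊕ ℕ))),
    ls.length = k ∧ (ladderLabels r ls).Nodup ∧
      ∀ x ∈ ladderLabels r ls, ∃ i, o ≤ i ∧ i ≤ o + 3 * k ∧ x = Sum.inr i := by
  induction k with
  | zero =>
    refine ⟨Sum.inr o, [], rfl, by simp [ladderLabels, netLabels], fun x hx => ⟨o, le_rfl, le_rfl, ?_⟩⟩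
    simpa [ladderLabels, netLabels] using hx
  | succ k ih =>
    obtain ⟨r, ls, rfl, hn, hl⟩ := ih
    have h : ∀ i, o + 3 * ls.length < i → Sum.inr i ∉ ladderLabels r ls := by
      intro i hi hm
      obtain ⟨j, -, hj, h⟩ := hl _ hm
      rw [Sum.inr.injEq] at h
      omega
    refine ⟨r, (Sum.inr (o + 3 * ls.length + 1), Sum.inr (o + 3 * ls.length + 2),
      Sum.inr (o + 3 * ls.length + 3)) :: ls, rfl, ?_, ?_⟩
    · change (_ :: _ :: _ :: ladderLabels r ls).Nodup
      rw [List.nodup_cons, List.nodup_cons, List.nodup_cons, List.mem_cons, List.mem_cons,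
        List.mem_cons]
      simp only [Sum.inr.injEq]
      refine ⟨?_, ?_, h _ (by omega), hn⟩
      · rintro (h' | h' | h')
        · omega
        · omega
        · exact h _ (by omega) h'
      · rintro (h' | h')
        · omega
        · exact h _ (by omega) h'
    · intro x hx
      change x ∈ _ :: _ :: _ :: ladderLabels r ls at hx
      rw [List.mem_cons, List.mem_cons, List.mem_cons] at hx
      rcases hx with rfl | rfl | rfl | hx
      · exact ⟨_, by omega, by omega, rfl⟩
      · exact ⟨_, by omega, by omega, rfl⟩
      · exact ⟨_, by omega, by omega, rfl⟩
      · obtain ⟨i, h1, h2, rfl⟩ := hl x hx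
        exact ⟨i, h1, by omega, rfl⟩

/-! ### The three pairings of the four ends. -/

/-- The place that is paired with the place `tl`. -/
def partner (σ : Equiv.Perm Ends) : Ends := σ (neighbour (σ.symm tl))

theorem partner_ne_tl (σ : Equiv.Perm Ends) : partner σ ≠ tl := by
  have h : ∀ x : Ends, neighbour x ≠ x := by decide
  intro h'
  exact h _ (σ.injective (h'.trans (σ.apply_symm_apply tl).symm))

set_option synthInstance.maxHeartbeats 200000 in
set_option synthInstance.maxSize 2000 in
/-- A function of four ends with the symmetries of a ladder depends only on the pairing. -/
theorem eq_of_partner {X : Type*} {F : Ends → Ends → Ends → Ends → X}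
    (h₁ : ∀ a b c d, F a b c d = F b a c d) (h₂ : ∀ a b c d, F a b c d = F a b d c)
    (h₃ : ∀ a b c d, F a b c d = F c d a b) (σ : Equiv.Perm Ends) :
    (partner σ = tr ∧ F (σ tl) (σ tr) (σ bl) (σ br) = F tl tr bl br) ∨
    (partner σ = bl ∧ F (σ tl) (σ tr) (σ bl) (σ br) = F tl bl tr br) ∨
    (partner σ = br ∧ F (σ tl) (σ tr) (σ bl) (σ br) = F tl br tr bl) := by
  -- The symmetries of `F` bring `tl` into the first argument; the second argument is then its
  -- partner.
  have key : ∀ b c d : Ends, b ≠ tl → c ≠ tl → d ≠ tl → b ≠ c → b ≠ d → c ≠ d →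
      (b = tr ∧ F tl b c d = F tl tr bl br) ∨ (b = bl ∧ F tl b c d = F tl bl tr br) ∨
        (b = br ∧ F tl b c d = F tl br tr bl) := by
    have h : ∀ b c d : Ends, b ≠ tl → c ≠ tl → d ≠ tl → b ≠ c → b ≠ d → c ≠ d →
        (b = tr ∧ c = bl ∧ d = br) ∨ (b = tr ∧ c = br ∧ d = bl) ∨ (b = bl ∧ c = tr ∧ d = br) ∨
        (b = bl ∧ c = br ∧ d = tr) ∨ (b = br ∧ c = tr ∧ d = bl) ∨ (b = br ∧ c = bl ∧ d = tr) := by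
      decide
    intro b c d hb hc hd hbc hbd hcd
    rcases h b c d hb hc hd hbc hbd hcd with ⟨rfl, rfl, rfl⟩ | ⟨rfl, rfl, rfl⟩ | ⟨rfl, rfl, rfl⟩ |
      ⟨rfl, rfl, rfl⟩ | ⟨rfl, rfl, rfl⟩ | ⟨rfl, rfl, rfl⟩
    · exact Or.inl ⟨rfl, rfl⟩
    · exact Or.inl ⟨rfl, h₂ _ _ _ _⟩
    · exact Or.inr (Or.inl ⟨rfl, rfl⟩)
    · exact Or.inr (Or.inl ⟨rfl, h₂ _ _ _ _⟩)
    · exact Or.inr (Or.inr ⟨rfl, rfl⟩)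
    · exact Or.inr (Or.inr ⟨rfl, h₂ _ _ _ _⟩)
  have inj : ∀ x y : Ends, x ≠ y → σ x ≠ σ y := fun x y h h' => h (σ.injective h')
  have hx : ∃ x, σ x = tl := σ.surjective tl
  obtain ⟨x, hx⟩ := hx
  have hp : partner σ = σ (neighbour x) := by
    rw [partner, ← hx, Equiv.symm_apply_apply]
  rw [hp]
  have hy : ∀ y, y ≠ x → σ y ≠ tl := fun y h => hx ▸ inj y x h
  have cases : ∀ x, x = tl ∨ x = tr ∨ x = bl ∨ x = br := by decide
  rcases cases x with rfl | rfl | rfl | rfl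
  · rw [hx]
    exact key _ _ _ (hy _ (by decide)) (hy _ (by decide)) (hy _ (by decide)) (inj _ _ (by decide))
      (inj _ _ (by decide)) (inj _ _ (by decide))
  · rw [hx, h₁]
    exact key _ _ _ (hy _ (by decide)) (hy _ (by decide)) (hy _ (by decide)) (inj _ _ (by decide))
      (inj _ _ (by decide)) (inj _ _ (by decide))
  · rw [hx, h₃]
    exact key _ _ _ (hy _ (by decide)) (hy _ (by decide)) (hy _ (by decide)) (inj _ _ (by decide))
      (inj _ _ (by decide)) (inj _ _ (by decide))
  · rw [hx, h₃, h₁]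
    exact key _ _ _ (hy _ (by decide)) (hy _ (by decide)) (hy _ (by decide)) (inj _ _ (by decide))
      (inj _ _ (by decide)) (inj _ _ (by decide))

set_option synthInstance.maxHeartbeats 200000 in
set_option synthInstance.maxSize 2000 in
-- If `tl` and `tr` received neighbouring ends, the two remaining ends would be neighbouring as
-- well.
theorem partner_ne_tr_of_bl {σ : Equiv.Perm Ends} (h : neighbour (σ.symm bl) ≠ σ.symm br) :
    partner σ ≠ tr := by
  intro hp
  rw [partner, ← Equiv.eq_symm_apply] at hp
  have key : ∀ a b c d : Ends, a ≠ b → a ≠ c → a ≠ d → b ≠ c → b ≠ d → c ≠ d →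
      neighbour a = b → neighbour c = d := by decide
  have inj : ∀ x y : Ends, x ≠ y → σ.symm x ≠ σ.symm y := fun x y h h' => h (σ.symm.injective h')
  exact h (key _ _ _ _ (inj tl tr (by decide)) (inj tl bl (by decide)) (inj tl br (by decide))
    (inj tr bl (by decide)) (inj tr br (by decide)) (inj bl br (by decide)) hp)

theorem partner_ne_tr_of_tl {σ : Equiv.Perm Ends} (h : neighbour (σ.symm tl) ≠ σ.symm tr) :
    partner σ ≠ tr := by
  intro hp
  rw [partner, ← Equiv.eq_symm_apply] at hp
  exact h hp

set_option synthInstance.maxHeartbeats 200000 in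
set_option synthInstance.maxSize 2000 in
/-- The pairing is determined by the partner of one place. -/
theorem conj_neighbour_eq {σ τ : Equiv.Perm Ends} (h : partner σ = partner τ) :
    σ * neighbour * σ⁻¹ = τ * neighbour * τ⁻¹ := by
  have key : ∀ a x y z : Ends, x ≠ tl → x ≠ a → a ≠ tl → y ≠ tl → y ≠ a → y ≠ x → z ≠ tl → z ≠ a →
      z ≠ x → y = z := by decide
  have n : ∀ x, neighbour (neighbour x) = x := by decide
  have n' : ∀ x, neighbour x ≠ x := by decide
  have hne : ∀ (ρ : Equiv.Perm Ends) (x : Ends), (ρ * neighbour * ρ⁻¹) x ≠ x := by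
    intro ρ x hx
    refine n' (ρ.symm x) (ρ.injective ?_)
    rw [ρ.apply_symm_apply]
    exact hx
  have hinv : ∀ (ρ : Equiv.Perm Ends) (x : Ends),
      (ρ * neighbour * ρ⁻¹) ((ρ * neighbour * ρ⁻¹) x) = x := by
    intro ρ x
    change ρ (neighbour (ρ.symm (ρ (neighbour (ρ.symm x))))) = x
    rw [ρ.symm_apply_apply, n, ρ.apply_symm_apply]
  have hp : ∀ ρ : Equiv.Perm Ends, (ρ * neighbour * ρ⁻¹) tl = partner ρ := fun ρ => rfl
  have hp' : ∀ ρ : Equiv.Perm Ends, (ρ * neighbour * ρ⁻¹) (partner ρ) = tl := fun ρ => hinv ρ tl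
  ext x : 1
  by_cases h1 : x = tl
  · rw [h1, hp, hp, h]
  by_cases h2 : x = partner σ
  · rw [h2, hp', h, hp']
  have h3 : ∀ ρ : Equiv.Perm Ends, x ≠ partner ρ → (ρ * neighbour * ρ⁻¹) x ≠ tl := by
    intro ρ hx h'
    rw [← hp, ← h', hinv] at hx
    exact hx rfl
  have h4 : ∀ ρ : Equiv.Perm Ends, (ρ * neighbour * ρ⁻¹) x ≠ partner ρ := by
    intro ρ h'
    rw [← hp] at h'
    exact h1 ((ρ * neighbour * ρ⁻¹).injective h')
  exact key (partner σ) x _ _ h1 h2 (partner_ne_tl σ) (h3 σ h2) (h4 σ) (hne σ x)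
    (h3 τ (h ▸ h2)) (h ▸ h4 τ) (hne τ x)

/-! ### Ladders with permuted ends. -/

namespace NetAlgebra

variable {L : Type} {A : Type*} [CommRing A] [Algebra ℚ A] {Γ : NetAlgebra L A}
  {D : L × List (L × L × L)} {σ : Equiv.Perm Ends}

namespace Symmetric

theorem lad_perm (h : Γ.Symmetric D) (w : Ends → L) (σ : Equiv.Perm Ends) :
    Γ.lad D (w (σ tl)) (w (σ tr)) (w (σ bl)) (w (σ br)) =
      Γ.lad D (w tl) (w tr) (w bl) (w br) := by
  rcases eq_of_partner (F := fun a b c d => Γ.lad D (w a) (w b) (w c) (w d))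
    (fun _ _ _ _ => h.swap₁ _ _ _ _) (fun _ _ _ _ => h.swap₃ _ _ _ _)
    (fun _ _ _ _ => h.flip _ _ _ _) σ with ⟨-, h'⟩ | ⟨-, h'⟩ | ⟨-, h'⟩
  · exact h'
  · rw [h', h.swap₂]
  · rw [h', h.swap₂, h.swap₃, h.swap₂, h.swap₃]

theorem lad_cons_of_partner (h : Γ.Symmetric D) (m m' r : L) (w : Ends → L)
    (σ : Equiv.Perm Ends) :
    (partner σ = tr ∧
      Γ.lad (D.1, (m, m', r) :: D.2) (w (σ tl)) (w (σ tr)) (w (σ bl)) (w (σ br)) =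
        -Γ.ext D m m' r (w tl) (w tr) (w bl) (w br)) ∨
    (partner σ = bl ∧
      Γ.lad (D.1, (m, m', r) :: D.2) (w (σ tl)) (w (σ tr)) (w (σ bl)) (w (σ br)) =
        -Γ.ext D m m' r (w tl) (w bl) (w tr) (w br)) ∨
    (partner σ = br ∧
      Γ.lad (D.1, (m, m', r) :: D.2) (w (σ tl)) (w (σ tr)) (w (σ bl)) (w (σ br)) =
        -Γ.ext D m m' r (w tl) (w br) (w tr) (w bl)) := by
  simp only [h.lad_cons]
  exact eq_of_partner (F := fun a b c d => -Γ.ext D m m' r (w a) (w b) (w c) (w d))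
    (fun _ _ _ _ => congrArg _ (h.ext_comm_left _ _ _ _ _ _ _))
    (fun _ _ _ _ => congrArg _ (h.ext_comm_right _ _ _ _ _ _ _))
    (fun _ _ _ _ => congrArg _ (h.ext_flip _ _ _ _ _ _ _)) σ

/-- Distinct pairings give `tl` distinct partners, which must be `tr`, `bl` and `br`. So the sum is
the one in `ext_sum`, up to sign. -/
theorem sum_lad_cons (h : Γ.Symmetric D) (m m' r : L) (w : Ends → L) (σ : Fin 3 → Equiv.Perm Ends)
    (hσ : Function.Injective fun i => σ i * neighbour * (σ i)⁻¹) :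
    ∑ i, Γ.lad (D.1, (m, m', r) :: D.2) (w (σ i tl)) (w (σ i tr)) (w (σ i bl)) (w (σ i br)) = 0 := by
  let G : Ends → A := fun e => if e = tr then -Γ.ext D m m' r (w tl) (w tr) (w bl) (w br) else
    if e = bl then -Γ.ext D m m' r (w tl) (w bl) (w tr) (w br) else
      -Γ.ext D m m' r (w tl) (w br) (w tr) (w bl)
  have hG : ∀ σ, Γ.lad (D.1, (m, m', r) :: D.2) (w (σ tl)) (w (σ tr)) (w (σ bl)) (w (σ br)) =
      G (partner σ) := by
    intro σ
    rcases h.lad_cons_of_partner m m' r w σ with ⟨h₁, h₂⟩ | ⟨h₁, h₂⟩ | ⟨h₁, h₂⟩ <;>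
      rw [h₁, h₂] <;> rfl
  have inj : Function.Injective fun i => partner (σ i) := fun i j hij => hσ (conj_neighbour_eq hij)
  have himage : Finset.univ.image (fun i => partner (σ i)) = {tr, bl, br} := by
    refine Finset.eq_of_subset_of_card_le ?_ ?_
    · intro e he
      obtain ⟨i, -, rfl⟩ := Finset.mem_image.1 he
      have : ∀ e, e ≠ tl → e ∈ ({tr, bl, br} : Finset Ends) := by decide
      exact this _ (partner_ne_tl _)
    · rw [Finset.card_image_of_injective _ inj]
      decide
  simp only [hG]
  rw [← Finset.sum_image (f := G) (fun i _ j _ hij => inj hij), himage,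
    Finset.sum_insert (by decide), Finset.sum_insert (by decide), Finset.sum_singleton]
  change -Γ.ext D m m' r (w tl) (w tr) (w bl) (w br) +
    (-Γ.ext D m m' r (w tl) (w bl) (w tr) (w br) + -Γ.ext D m m' r (w tl) (w br) (w tr) (w bl)) = 0
  linear_combination -h.ext_sum m m' r (w tl) (w tr) (w bl) (w br)

theorem lad_mul_rung (h : Γ.Symmetric D) (e e' r x y s a b c d : L) (w : Ends → L)
    (hw : w = Sum.elim ![a, b] ![x, y]) (hσ : partner σ ≠ tr) :
    2 * (Γ.lad (D.1, (e, e', r) :: D.2) (w (σ tl)) (w (σ tr)) (w (σ bl)) (w (σ br)) *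
      Γ.lad (s, []) x y c d) =
      -Γ.lad (D.1, (x, y, s) :: (e, e', r) :: D.2) a b c d := by
  have h1 : ∀ a b, 2 * (Γ.ext D e e' r x a y b * Γ.lad (s, []) x y c d) =
      Γ.ext₂ D e e' r x y s c d a b := by
    intro a b
    have := h.ext_across e e' r x y s c d a b
    rw [lad_nil, Γ.anti s x c, Γ.f_right s d y]
    linear_combination -this
  rcases h.lad_cons_of_partner e e' r w σ with ⟨h₁, h₂⟩ | ⟨h₁, h₂⟩ | ⟨h₁, h₂⟩
  · exact absurd h₁ hσ
  · rw [h₂, h.lad_cons_cons, hw]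
    change 2 * (-Γ.ext D e e' r a x b y * _) = _
    rw [h.ext_comm_left, h.ext_comm_right]
    linear_combination -h1 a b
  · rw [h₂, h.lad_cons_cons, hw]
    change 2 * (-Γ.ext D e e' r a y b x * _) = _
    rw [h.ext_flip, h.ext_comm_left, h.ext_comm_right, h.ext₂_comm_right]
    linear_combination -h1 b a

end Symmetric

/-- The pairing conditions leave two cases for each ladder, which differ by exchanging `a` and `b`,
or `c` and `d`. The even ladder on the right does not see the difference, so one case, `parallel`,
is enough. -/
theorem lad_mul_lad {T S : L × List (L × L × L)} (hT : Γ.Symmetric T) (hS : Γ.Symmetric S)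
    (hV : ∀ m m', Γ.Symmetric (stack T S m m')) (e₁ e₂ e₃ e₄ x y m n a b c d : L) {w v : Ends → L}
    {σ τ : Equiv.Perm Ends} (hw : w = Sum.elim ![a, b] ![m, n]) (hv : v = Sum.elim ![m, n] ![c, d])
    (hσ : partner σ ≠ tr) (hτ : partner τ ≠ tr) :
    4 * (Γ.lad (T.1, (e₁, e₂, x) :: T.2) (w (σ tl)) (w (σ tr)) (w (σ bl)) (w (σ br)) *
      Γ.lad (S.1, (e₃, e₄, y) :: S.2) (v (τ tl)) (v (τ tr)) (v (τ bl)) (v (τ br))) =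
      Γ.lad ((stack T S y e₃).1, (e₁, e₄, n) :: (e₂, x, m) :: (stack T S y e₃).2) a b c d := by
  have key := Symmetric.parallel hT hS hV
  have hD := (hV y e₃).cons_cons e₂ x m e₁ e₄ n
  have h1 : ∃ a' b', (a' = a ∧ b' = b ∨ a' = b ∧ b' = a) ∧
      Γ.lad (T.1, (e₁, e₂, x) :: T.2) (w (σ tl)) (w (σ tr)) (w (σ bl)) (w (σ br)) =
        Γ.lad (T.1, (e₁, e₂, x) :: T.2) a' m b' n := by
    rcases hT.lad_cons_of_partner e₁ e₂ x w σ with ⟨h₁, h₂⟩ | ⟨h₁, h₂⟩ | ⟨h₁, h₂⟩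
    · exact absurd h₁ hσ
    · exact ⟨a, b, Or.inl ⟨rfl, rfl⟩, by rw [h₂, hw, hT.lad_cons]; rfl⟩
    · exact ⟨b, a, Or.inr ⟨rfl, rfl⟩, by rw [h₂, hw, hT.lad_cons, hT.ext_flip]; rfl⟩
  have h2 : ∃ c' d', (c' = c ∧ d' = d ∨ c' = d ∧ d' = c) ∧
      Γ.lad (S.1, (e₃, e₄, y) :: S.2) (v (τ tl)) (v (τ tr)) (v (τ bl)) (v (τ br)) =
        Γ.lad (S.1, (e₃, e₄, y) :: S.2) m c' n d' := by
    rcases hS.lad_cons_of_partner e₃ e₄ y v τ with ⟨h₁, h₂⟩ | ⟨h₁, h₂⟩ | ⟨h₁, h₂⟩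
    · exact absurd h₁ hτ
    · exact ⟨c, d, Or.inl ⟨rfl, rfl⟩, by rw [h₂, hv, hS.lad_cons]; rfl⟩
    · exact ⟨d, c, Or.inr ⟨rfl, rfl⟩, by rw [h₂, hv, hS.lad_cons]; rfl⟩
  obtain ⟨a', b', hab, h1⟩ := h1
  obtain ⟨c', d', hcd, h2⟩ := h2
  rw [h1, h2, key]
  have h3 : ∀ c d, Γ.lad ((stack T S y e₃).1, (e₁, e₄, n) :: (e₂, x, m) :: (stack T S y e₃).2)
      a' b' c d = Γ.lad ((stack T S y e₃).1, (e₁, e₄, n) :: (e₂, x, m) :: (stack T S y e₃).2)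
      a b c d := by
    intro c d
    rcases hab with ⟨rfl, rfl⟩ | ⟨rfl, rfl⟩
    · rfl
    · exact hD.swap₁ _ _ _ _
  rw [h3]
  rcases hcd with ⟨rfl, rfl⟩ | ⟨rfl, rfl⟩
  · rfl
  · exact hD.swap₃ _ _ _ _

end NetAlgebra

/-! ### The four relations for diagrams. -/

namespace Rest

variable (C : Rest Ends u)

theorem value_ladder {D : C.Label × List (C.Label × C.Label × C.Label)} {n : ℕ}
    (hn : D.2.length + 1 = n) (hD : (ladderLabels D.1 D.2).Nodup)
    (h : ∀ x ∈ ladderLabels D.1 D.2, ∃ i, x = Sum.inr i) :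
    C.value (ladder n) = C.context.eval (C.context.netAlgebra.lad D
      (C.place tl) (C.place tr) (C.place bl) (C.place br)) := by
  subst hn
  exact C.value_eq_eval (Piece.HasNet.ladder D.1 D.2 C.place) hD h

theorem value_ladder_rename {D : C.Label × List (C.Label × C.Label × C.Label)} {n : ℕ}
    (hn : D.2.length + 1 = n) (hD : (ladderLabels D.1 D.2).Nodup)
    (h : ∀ x ∈ ladderLabels D.1 D.2, ∃ i, x = Sum.inr i) (σ : Equiv.Perm Ends) :
    C.value ((ladder n).rename σ) = C.context.eval (C.context.netAlgebra.lad D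
      (C.place (σ tl)) (C.place (σ tr)) (C.place (σ bl)) (C.place (σ br))) := by
  subst hn
  have h1 := (Piece.HasNet.ladder D.1 D.2 (C.place ∘ σ)).rename σ
  rw [show (C.place ∘ σ) ∘ σ.symm = C.place by ext x : 1; simp] at h1
  exact C.value_eq_eval h1 hD h

end Rest

theorem ladderLabels_cons {X : Type} (r m m' r' : X) (ls : List (X × X × X)) :
    ladderLabels r ((m, m', r') :: ls) = m :: m' :: r' :: ladderLabels r ls := rfl

theorem ladderLabels_append {X : Type} (r : X) (ls ks : List (X × X × X)) :
    ladderLabels r (ls ++ ks) = netLabels ls ++ ladderLabels r ks := by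
  rw [ladderLabels, ladderLabels, netLabels, List.flatMap_append, List.append_assoc]
  rfl

/-- The two sides of `parallel` use the same inner labels in different places, so distinctness on
one side gives it on the other. -/
theorem ladderLabels_parallel_perm {X : Type} [DecidableEq X] (r : X) (ls : List (X × X × X))
    (r' : X) (ks : List (X × X × X)) (y e₃ e₁ e₄ z₂ e₂ x z₁ : X) :
    (ladderLabels (NetAlgebra.stack (r, ls) (r', ks) y e₃).1 ((e₁, e₄, z₂) ::
      (e₂, x, z₁) :: (NetAlgebra.stack (r, ls) (r', ks) y e₃).2)).Perm
      (z₁ :: z₂ :: (ladderLabels r ((e₁, e₂, x) :: ls) ++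
        ladderLabels r' ((e₃, e₄, y) :: ks))) := by
  rw [List.perm_iff_count]
  intro z
  simp only [ladderLabels_cons, NetAlgebra.stack, ladderLabels_append, List.count_cons,
    List.count_append]
  rw [show ladderLabels r' ks = netLabels ks ++ [r'] from rfl, List.count_append,
    List.count_singleton]
  ring

theorem exists_eq_cons {X : Type} {ls : List X} {n : ℕ} (h : ls.length = n + 1) :
    ∃ x ks, ls = x :: ks ∧ ks.length = n := by
  cases ls with
  | nil => cases h
  | cons x ks => exact ⟨x, ks, rfl, Nat.succ_injective h⟩

theorem eq_smul_of_mul_eq {A : Type*} [CommRing A] [Algebra ℚ A] {n : ℕ} (hn : n ≠ 0) {x : ℚ}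
    {p q : A} (h : (n : A) * p = x • q) : p = (x / n) • q := by
  rw [div_eq_inv_mul, mul_smul, ← h, Algebra.smul_def, ← mul_assoc, ← map_natCast (algebraMap ℚ A),
    ← map_mul, inv_mul_cancel₀ (Nat.cast_ne_zero.2 hn), map_one, one_mul]

namespace Rest

variable (C : Rest Ends u)

/-- A ladder with an even number of rungs is symmetric in its four ends. -/
theorem value_ladder_even {m : ℕ} (hm : 1 ≤ m) (σ : Equiv.Perm Ends) :
    C.value ((ladder (2 * m)).rename σ) = C.value (ladder (2 * m)) := by
  -- The list has one entry for each rung except the topmost, so an even number of rungs means an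
  -- odd length.
  obtain ⟨r, ls, hl, hn, hf⟩ := exists_fresh (X := Sym2 (Ends ⊕ (C.K ⊕ C.U))) (2 * m - 1) 0
  have hf' : ∀ x ∈ ladderLabels r ls, ∃ i, x = Sum.inr i := fun x hx =>
    (hf x hx).imp fun _ h => h.2.2
  have hs : C.context.netAlgebra.Symmetric (r, ls) :=
    NetAlgebra.symmetric_of_odd _ r ls ⟨m - 1, by omega⟩
  rw [C.value_ladder_rename (D := (r, ls)) (by dsimp only; omega) hn hf',
    C.value_ladder (D := (r, ls)) (by dsimp only; omega) hn hf', hs.lad_perm]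

/-- The sum over the three ways to attach a ladder with an odd number of rungs vanishes. -/
theorem sum_value_ladder_odd {m : ℕ} (hm : 1 ≤ m) (σ : Fin 3 → Equiv.Perm Ends)
    (hσ : Function.Injective fun i => σ i * neighbour * (σ i)⁻¹) :
    ∑ i, C.value ((ladder (2 * m + 1)).rename (σ i)) = 0 := by
  obtain ⟨r, ls', hl, hn, hf⟩ := exists_fresh (X := Sym2 (Ends ⊕ (C.K ⊕ C.U))) (2 * m - 1 + 1) 0
  have hf' : ∀ x ∈ ladderLabels r ls', ∃ i, x = Sum.inr i := fun x hx =>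
    (hf x hx).imp fun _ h => h.2.2
  obtain ⟨⟨e, e', t⟩, ls, rfl, hl'⟩ := exists_eq_cons hl
  have hs : C.context.netAlgebra.Symmetric (r, ls) :=
    NetAlgebra.symmetric_of_odd _ r ls ⟨m - 1, by omega⟩
  rw [Finset.sum_congr rfl fun i _ => C.value_ladder_rename (D := (r, (e, e', t) :: ls))
    (by dsimp only; omega) hn hf' (σ i), ← map_sum, hs.sum_lad_cons e e' t C.place σ hσ, map_zero]

/-- A rung glued to two ends of a ladder that are not neighbouring. -/
theorem value_glue_rung {m : ℕ} (hm : 1 ≤ m) {σ : Equiv.Perm Ends} (hσ : partner σ ≠ tr) :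
    C.value (((ladder (2 * m + 1)).rename σ).glue rung) =
      (-1 / 2 : ℚ) • C.value (ladder (2 * m + 2)) := by
  obtain ⟨r, ls', hl, hn, hf⟩ :=
    exists_fresh (X := Sym2 (Ends ⊕ (C.K ⊕ C.U))) (2 * m - 1 + 1 + 1) 0
  have hf' : ∀ x ∈ ladderLabels r ls', ∃ i, x = Sum.inr i := fun x hx =>
    (hf x hx).imp fun _ h => h.2.2
  obtain ⟨⟨x, y, s⟩, ls'', rfl, hl'⟩ := exists_eq_cons hl
  obtain ⟨⟨e, e', t⟩, ls, rfl, hl''⟩ := exists_eq_cons hl'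
  have hs : C.context.netAlgebra.Symmetric (r, ls) :=
    NetAlgebra.symmetric_of_odd _ r ls ⟨m - 1, by omega⟩
  set w : Ends → C.Label := Sum.elim ![C.place tl, C.place tr] ![x, y] with hw
  have h1 := (Piece.HasNet.ladder r ((e, e', t) :: ls) (w ∘ σ)).rename σ
  rw [show (w ∘ σ) ∘ σ.symm = w by ext x : 1; simp, hl'] at h1
  have h2 := Piece.HasNet.rung (Sum.elim ![x, y] ![C.place bl, C.place br]) s
  have h3 := h1.glue h2
  rw [show Sum.elim ![C.place tl, C.place tr] ![C.place bl, C.place br] = C.place by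
    ext (i | i) : 1 <;> fin_cases i <;> rfl, ← netMultiset_append] at h3
  rw [ladderLabels_cons] at hn hf'
  have hn' := hn
  rw [List.nodup_cons, List.nodup_cons, List.nodup_cons, List.mem_cons, List.mem_cons,
    List.mem_cons, not_or, not_or, not_or] at hn
  obtain ⟨⟨h01, h02, h03⟩, ⟨h04, h05⟩, h06, h07⟩ := hn
  have h4 := C.value_eq_eval h3 ⟨h07, trivial, Set.disjoint_singleton_right.2 h06, by
    rw [Set.disjoint_right]
    rintro _ ⟨i, rfl⟩
    fin_cases i
    · exact fun h => h.elim h03 h02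
    · exact fun h => h.elim h05 h04, by
    intro i j hij
    fin_cases i <;> fin_cases j
    · rfl
    · exact absurd hij h01
    · exact absurd hij.symm h01
    · rfl⟩ (by
    rintro z ((hz | rfl) | ⟨i, rfl⟩)
    · exact hf' z (by simp [hz.out])
    · exact hf' z (by simp)
    · fin_cases i
      · exact hf' x (by simp)
      · exact hf' y (by simp))
  rw [show 2 * m + 1 = 2 * m - 1 + 1 + 1 by omega, h4, netProd_append,
    C.value_ladder (D := (r, (x, y, s) :: (e, e', t) :: ls)) (by dsimp only; omega) hn' hf']
  have h5 := hs.lad_mul_rung e e' t x y s (C.place tl) (C.place tr) (C.place bl) (C.place br) w hw hσ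
  rw [← neg_one_smul ℚ] at h5
  have h6 := congrArg C.context.eval (eq_smul_of_mul_eq (n := 2) two_ne_zero
    (by rw [Nat.cast_ofNat]; exact h5))
  rw [map_smul, Nat.cast_ofNat] at h6
  exact h6

/-- Two ladders glued along two ends of each that are not neighbouring. -/
theorem value_glue_ladder {n m : ℕ} (hn : 1 ≤ n) (hm : 1 ≤ m) {σ τ : Equiv.Perm Ends}
    (hσ : partner σ ≠ tr) (hτ : partner τ ≠ tr) :
    C.value (((ladder (2 * n + 1)).rename σ).glue ((ladder (2 * m + 1)).rename τ)) =
      (1 / 4 : ℚ) • C.value (ladder (2 * n + 2 * m + 2)) := by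
  -- The offset 2 reserves the labels 0 and 1 for the two glued strands; the labels of the second
  -- ladder start after those of the first.
  obtain ⟨r, ls', hl, hn₁, hf₁⟩ := exists_fresh (X := Sym2 (Ends ⊕ (C.K ⊕ C.U))) (2 * n - 1 + 1) 2
  obtain ⟨r', ks', hl', hn₂, hf₂⟩ := exists_fresh (X := Sym2 (Ends ⊕ (C.K ⊕ C.U))) (2 * m - 1 + 1)
    (2 + 3 * (2 * n - 1 + 1) + 1)
  obtain ⟨⟨e₁, e₂, x⟩, ls, rfl, hl₁⟩ := exists_eq_cons hl
  obtain ⟨⟨e₃, e₄, y⟩, ks, rfl, hl₂⟩ := exists_eq_cons hl'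
  have hT : C.context.netAlgebra.Symmetric (r, ls) :=
    NetAlgebra.symmetric_of_odd _ r ls ⟨n - 1, by omega⟩
  have hS : C.context.netAlgebra.Symmetric (r', ks) :=
    NetAlgebra.symmetric_of_odd _ r' ks ⟨m - 1, by omega⟩
  have hV : ∀ z z', C.context.netAlgebra.Symmetric (NetAlgebra.stack (r, ls) (r', ks) z z') :=
    fun z z' => NetAlgebra.symmetric_of_odd _ _ _ ⟨n + m - 1, by
      rw [List.length_append, List.length_cons]
      dsimp only
      omega⟩
  set z₁ : C.Label := Sum.inr 0 with hz₁
  set z₂ : C.Label := Sum.inr 1 with hz₂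
  set w : Ends → C.Label := Sum.elim ![C.place tl, C.place tr] ![z₁, z₂] with hw
  set v : Ends → C.Label := Sum.elim ![z₁, z₂] ![C.place bl, C.place br] with hv
  have h1 := (Piece.HasNet.ladder r ((e₁, e₂, x) :: ls) (w ∘ σ)).rename σ
  have h2 := (Piece.HasNet.ladder r' ((e₃, e₄, y) :: ks) (v ∘ τ)).rename τ
  rw [show (w ∘ σ) ∘ σ.symm = w by ext x : 1; simp, hl] at h1
  rw [show (v ∘ τ) ∘ τ.symm = v by ext x : 1; simp, hl'] at h2
  have h3 := h1.glue h2
  rw [show Sum.elim ![C.place tl, C.place tr] ![C.place bl, C.place br] = C.place by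
    ext (i | i) : 1 <;> fin_cases i <;> rfl, ← netMultiset_append] at h3
  have d₁ : Disjoint {z | z ∈ ladderLabels r ((e₁, e₂, x) :: ls)}
      {z | z ∈ ladderLabels r' ((e₃, e₄, y) :: ks)} := by
    rw [Set.disjoint_left]
    intro z hz hz'
    obtain ⟨i, -, hi, rfl⟩ := hf₁ z hz
    obtain ⟨j, hj, -, h⟩ := hf₂ _ hz'
    rw [Sum.inr.injEq] at h
    omega
  have d₂ : ∀ z ∈ {z | z ∈ ladderLabels r ((e₁, e₂, x) :: ls)} ∪
      {z | z ∈ ladderLabels r' ((e₃, e₄, y) :: ks)}, ∃ i, 2 ≤ i ∧ z = Sum.inr i := by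
    rintro z (hz | hz)
    · obtain ⟨i, hi, -, h⟩ := hf₁ z hz
      exact ⟨i, hi, h⟩
    · obtain ⟨i, hi, -, h⟩ := hf₂ z hz
      exact ⟨i, by omega, h⟩
  have d₃ : ∀ i, ∃ j, j < 2 ∧ (![z₁, z₂] : Fin 2 → C.Label) i = Sum.inr j := by
    intro i
    fin_cases i
    · exact ⟨0, by omega, rfl⟩
    · exact ⟨1, by omega, rfl⟩
  have d₄ : Disjoint ({z | z ∈ ladderLabels r ((e₁, e₂, x) :: ls)} ∪
      {z | z ∈ ladderLabels r' ((e₃, e₄, y) :: ks)}) (Set.range ![z₁, z₂]) := by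
    rw [Set.disjoint_left]
    rintro z hz ⟨i, rfl⟩
    obtain ⟨j, hj, h⟩ := d₂ _ hz
    obtain ⟨j', hj', h'⟩ := d₃ i
    rw [h', Sum.inr.injEq] at h
    omega
  have d₅ : z₁ ≠ z₂ := by
    rw [hz₁, hz₂, ne_eq, Sum.inr.injEq]
    omega
  have d₆ : Function.Injective ![z₁, z₂] := by
    intro i j hij
    fin_cases i <;> fin_cases j
    · rfl
    · exact absurd hij d₅
    · exact absurd hij.symm d₅
    · rfl
  have h4 := C.value_eq_eval h3 ⟨hn₁, hn₂, d₁, d₄, d₆⟩ (by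
    rintro z (hz | ⟨i, rfl⟩)
    · exact (d₂ z hz).imp fun _ h => h.2
    · exact (d₃ i).imp fun _ h => h.2)
  have hperm : (ladderLabels (NetAlgebra.stack (r, ls) (r', ks) y e₃).1 ((e₁, e₄, z₂) ::
      (e₂, x, z₁) :: (NetAlgebra.stack (r, ls) (r', ks) y e₃).2)).Perm
      (z₁ :: z₂ :: (ladderLabels r ((e₁, e₂, x) :: ls) ++ ladderLabels r' ((e₃, e₄, y) :: ks))) := by
    classical
    exact ladderLabels_parallel_perm r ls r' ks y e₃ e₁ e₄ z₂ e₂ x z₁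
  have hnodup := hperm.nodup_iff.2 (by
    rw [List.nodup_cons, List.nodup_cons, List.nodup_append']
    refine ⟨?_, ?_, hn₁, hn₂, fun z hz hz' => Set.disjoint_left.1 d₁ hz hz'⟩
    · rw [List.mem_cons, List.mem_append]
      rintro (h | h)
      · exact d₅ h
      · exact Set.disjoint_left.1 d₄ h ⟨0, rfl⟩
    · rw [List.mem_append]
      exact fun h => Set.disjoint_left.1 d₄ h ⟨1, rfl⟩)
  have h5 := NetAlgebra.lad_mul_lad hT hS hV e₁ e₂ e₃ e₄ x y z₁ z₂ (C.place tl) (C.place tr)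
    (C.place bl) (C.place br) hw hv hσ hτ
  rw [← one_smul ℚ (NetAlgebra.lad _ _ (C.place tl) (C.place tr) (C.place bl) (C.place br))] at h5
  rw [show 2 * n + 1 = 2 * n - 1 + 1 + 1 by omega, show 2 * m + 1 = 2 * m - 1 + 1 + 1 by omega, h4,
    netProd_append, C.value_ladder (D := (_, _)) _ hnodup]
  · have h6 := congrArg C.context.eval (eq_smul_of_mul_eq (n := 4) four_ne_zero
      (by rw [Nat.cast_ofNat]; exact h5))
    rw [map_smul, Nat.cast_ofNat] at h6
    exact h6
  · intro z hz
    rw [hperm.mem_iff, List.mem_cons, List.mem_cons, List.mem_append] at hz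
    rcases hz with rfl | rfl | hz
    · exact ⟨0, rfl⟩
    · exact ⟨1, rfl⟩
    · exact (d₂ z hz).imp fun _ h => h.2
  · simp only [NetAlgebra.stack, List.length_append, List.length_cons]
    omega

end Rest

end Diagrams

theorem theorem1 {k : ℕ} (u : Fin k → ℕ) (C : Rest Ends u) :
    -- (LS)
    (∀ m : ℕ, 1 ≤ m → ∀ σ : Equiv.Perm Ends,
      C.value ((ladder (2 * m)).rename σ) = C.value (ladder (2 * m))) ∧
    -- (LIHX): the three ladders pair the four places as neighbours in the three possible ways
    (∀ m : ℕ, 1 ≤ m → ∀ σ : Fin 3 → Equiv.Perm Ends,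
      Function.Injective (fun i => σ i * neighbour * (σ i)⁻¹) →
      ∑ i, C.value ((ladder (2 * m + 1)).rename (σ i)) = 0) ∧
    -- (LI): an edge is glued to two ends that are not neighbouring
    (∀ m : ℕ, 1 ≤ m → ∀ σ : Equiv.Perm Ends,
      neighbour (σ.symm bl) ≠ σ.symm br →
      C.value (((ladder (2 * m + 1)).rename σ).glue rung) =
        (-1 / 2 : ℚ) • C.value (ladder (2 * m + 2))) ∧
    -- (LL): two ladders are glued along two ends of each that are not neighbouring
    (∀ n m : ℕ, 1 ≤ n → 1 ≤ m → ∀ σ τ : Equiv.Perm Ends,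
      neighbour (σ.symm bl) ≠ σ.symm br → neighbour (τ.symm tl) ≠ τ.symm tr →
      C.value (((ladder (2 * n + 1)).rename σ).glue ((ladder (2 * m + 1)).rename τ)) =
        (1 / 4 : ℚ) • C.value (ladder (2 * n + 2 * m + 2))) := by
  refine ⟨fun m hm σ => C.value_ladder_even hm σ, fun m hm σ hσ => C.sum_value_ladder_odd hm σ hσ,
    fun m hm σ hσ => C.value_glue_rung hm (partner_ne_tr_of_bl hσ), fun n m hn hm σ τ hσ hτ =>
    C.value_glue_ladder hn hm (partner_ne_tr_of_bl hσ) (partner_ne_tr_of_tl hτ)⟩
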